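/- Let $X$ be a finite alphabet and let $A=(S,X,t,o)$ be a finite invertible automaton over $X$: $S$ is a finite set of states, $t:S\times X\to S$ and $o:S\times X\to X$ are maps, and $o(s,\cdot)$ is a permutation of $X$ for every $s\in S$. Each state $s$ acts on the set $X^*$ of words by $o(s,\varepsilon)=\varepsilon$, $o(s,xv)=o(s,x)\,o(t(s,x),v)$. Assume that different states define different transformations of $X^*$ and that the set of these transformations is closed under inversion, and let $G\le \mathrm{Sym}(X^*)$ be the automaton group generated by them (acting from the right, so that a word $s_1s_2\cdots s_n\in S^*$ represents the transformation "first $s_1$, then $s_2$, …"). For $g\in G$ let $l_S(g)$ be the length of a shortest word over $S$ representing $g$; for a word $u\in S^*$ write $l_S(u)$ for $l_S$ of the element it represents. For $w=s_1\cdots s_n\in S^*$ and $x\in X$ the section of $w$ at $x$ is the word $w|_x=s_1'\cdots s_n'\in S^*$ with $s_i'=t(s_i,x_i)$, where $x_1=x$ and $x_{i+1}=o(s_i,x_i)$. Let $\mathrm{DTIME}_*(f(n))$ be the class of languages decided in time $O(f(n))$ by a deterministic Turing machine with finitely many tapes, and let $\mathrm{P}$ be the class of languages decided in polynomial time. Write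 $\mathrm{WP}_G\in\mathcal C$ if, for every finite generating set $T$ of $G$ closed under inversion, the language of all words over $T$ that represent the identity of $G$ belongs to $\mathcal C$. Let $L\ge 1$ be an integer. Then: 1. If $l_S(w|_x)<|w|$ for all $w\in S^L$ and all $x\in X$, then $\mathrm{WP}_G\in\mathrm{P}$. 2. If $\sum_{x\in X} l_S(w|_x)\le |w|$ for all $w\in S^L$, then $\mathrm{WP}_G\in\mathrm{DTIME}_*(n\log n)$. 3. If $\sum_{x\in X} l_S(w|_x)<|w|$ for all $w\in S^L$, then $\mathrm{WP}_G\in\mathrm{DTIME}_*(n)$. -/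

import Mathlib

universe u v

/-! ### Deterministic multi-tape Turing machines and time complexity -/

/-- A deterministic Turing machine with input alphabet `A` and `k + 1` two-way infinite tapes.
Tape cells hold elements of `Option Γ`, where `none` is the blank symbol; the input alphabet is
embedded into the non-blank symbols `Γ`. The transition function sends the current state and the
scanned symbols to the new state and, for every tape, the symbol written and the head move
(`none` means that the head stays put). -/
structure MultiTapeTM (A : Type u) (k : ℕ) where
  Q : Type
  Γ : Type
  finite_Q : Finite Q
  finite_Γ : Finite Γ
  inp : A ↪ Γ
  start : Q
  accept : Q
  reject : Q
  accept_ne_reject : accept ≠ reject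
  δ : Q → (Fin (k + 1) → Option Γ) → Q × (Fin (k + 1) → Option Γ × Option Turing.Dir)

namespace MultiTapeTM

variable {A : Type u} {k : ℕ}

/-- A configuration: the state and the content of every tape (with its head position). -/
structure Cfg (M : MultiTapeTM A k) where
  state : M.Q
  tapes : Fin (k + 1) → Turing.Tape (Option M.Γ)

/-- The initial configuration on input `w`: the input is on tape `0`, with the head on its first
letter, and all other tapes are blank. -/
def init (M : MultiTapeTM A k) (w : List A) : M.Cfg where
  state := M.start
  tapes := fun i => Turing.Tape.mk₁ (if i = 0 then w.map (fun a => some (M.inp a)) else [])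

/-- Write the symbol `p.1` in the scanned cell, then move the head as told by `p.2`. -/
def act {Γ : Type} (T : Turing.Tape (Option Γ)) (p : Option Γ × Option Turing.Dir) :
    Turing.Tape (Option Γ) :=
  match p.2 with
  | none => T.write p.1
  | some d => (T.write p.1).move d

open Classical in
/-- One step of computation. The machine halts in its accepting and rejecting states:
configurations with such a state are left unchanged. -/
noncomputable def step (M : MultiTapeTM A k) (c : M.Cfg) : M.Cfg :=
  if c.state = M.accept ∨ c.state = M.reject then c
  else
    { state := (M.δ c.state (fun i => (c.tapes i).head)).1
      tapes := fun i => act (c.tapes i) ((M.δ c.state (fun j => (c.tapes j).head)).2 i) }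

/-- `M` decides the language `K` in time `f`: on every input `w` it halts after at most `f |w|`
steps, in the accepting state if `w ∈ K` and in the rejecting state otherwise. -/
def DecidesInTime (M : MultiTapeTM A k) (K : Language A) (f : ℕ → ℕ) : Prop :=
  ∀ w : List A,
    (w ∈ K → (M.step^[f w.length] (M.init w)).state = M.accept) ∧
    (w ∉ K → (M.step^[f w.length] (M.init w)).state = M.reject)

end MultiTapeTM

/-- A complexity class: a collection of languages over every alphabet. -/
def ComplexityClass : Type (u + 1) := ∀ A : Type u, Set (Language A)

/-- The class of languages decided in time `O(t(n))` by a deterministic Turing machine with some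
finite number of tapes. -/
def DTIMEMulti (t : ℕ → ℝ) : ComplexityClass.{u} := fun A =>
  {K | ∃ (k : ℕ) (M : MultiTapeTM A k) (f : ℕ → ℕ),
    (fun n => (f n : ℝ)) =O[Filter.atTop] t ∧ M.DecidesInTime K f}

/-- The class of languages decided in polynomial time. -/
def PolyTime : ComplexityClass.{u} := fun A =>
  {K | ∃ d : ℕ, K ∈ DTIMEMulti (fun n => (n : ℝ) ^ d) A}

/-! ### Word length and the word problem -/

/-- The length of a shortest word over `S` that represents `g`, where a letter `s` stands for the
element `φ s`. -/
noncomputable def wordLength {G : Type v} [Group G] {S : Type u} (φ : S → G) (g : G) : ℕ :=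
  sInf {n | ∃ w : List S, w.length = n ∧ (w.map φ).prod = g}

/-- The word problem of `G` with respect to `T`: the words over `T` that represent `1`. -/
def wordProblem {G : Type u} [Group G] (T : Finset G) : Language T :=
  {w : List T | (w.map Subtype.val).prod = 1}

/-- `G` is finitely generated, and its word problem with respect to every finite generating set
closed under inversion belongs to the class `C`. -/
def WordProblemIn (G : Type u) [Group G] (C : ComplexityClass.{u}) : Prop :=
  Group.FG G ∧ ∀ T : Finset G, (∀ a ∈ T, a⁻¹ ∈ T) → Subgroup.closure (T : Set G) = ⊤ →
    wordProblem T ∈ C T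

/-! ### Automaton groups -/

/-- An invertible automaton with set of states `S` over the alphabet `X`: a transition map and an
output map such that every state permutes `X`. -/
structure InvertibleAutomaton (S : Type u) (X : Type v) where
  t : S → X → S
  o : S → Equiv.Perm X

namespace InvertibleAutomaton

variable {S : Type u} {X : Type v} (A : InvertibleAutomaton S X)

/-- The terminal state `t(s, v)` after reading the word `v`. -/
def tWord : S → List X → S
  | s, [] => s
  | s, x :: v => tWord (A.t s x) v

/-- The output word `o(s, v)` on the input word `v`. -/
def oWord : S → List X → List X
  | _, [] => []
  | s, x :: v => A.o s x :: oWord (A.t s x) v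

theorem oWord_bijective (s : S) : Function.Bijective (A.oWord s) := by
  constructor
  · intro v
    induction v generalizing s with
    | nil => intro v' h; cases v' with
      | nil => rfl
      | cons y v' => simp [oWord] at h
    | cons x v ih => intro v' h; cases v' with
      | nil => simp [oWord] at h
      | cons y v' =>
        simp only [oWord, List.cons.injEq, EmbeddingLike.apply_eq_iff_eq] at h
        obtain ⟨rfl, h⟩ := h
        rw [ih _ h]
  · intro v
    induction v generalizing s with
    | nil => exact ⟨[], rfl⟩
    | cons y v ih =>
      obtain ⟨v', hv'⟩ := ih (A.t s ((A.o s).symm y))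
      exact ⟨(A.o s).symm y :: v', by simp [oWord, hv']⟩

/-- The transformation `o(s, ·)` of `X*`, a permutation. -/
noncomputable def statePerm (s : S) : Equiv.Perm (List X) :=
  Equiv.ofBijective (A.oWord s) (A.oWord_bijective s)

/-- The automaton group, generated by the transformations `o(s, ·)`. Permutations act on words from
the right (a product `g * h` means: first `g`, then `h`), whence the opposite group. -/
def group : Subgroup (Equiv.Perm (List X))ᵐᵒᵖ :=
  Subgroup.closure (Set.range fun s => MulOpposite.op (A.statePerm s))

/-- The generator given by a state. -/
noncomputable def gen (s : S) : A.group :=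
  ⟨MulOpposite.op (A.statePerm s), Subgroup.subset_closure ⟨s, rfl⟩⟩

/-- The element of the automaton group represented by a word over the states. -/
noncomputable def eval (w : List S) : A.group := (w.map A.gen).prod

/-- The section `w|_v = t(w, v)` of a word `w` over the states at a word `v` over `X`. -/
def sec : List S → List X → List S
  | [], _ => []
  | s :: w, v => A.tWord s v :: sec w (A.oWord s v)

/-- `l_S(w)`: the length of a shortest word over the states that represents the same element of
the automaton group as `w`. -/
noncomputable def len (w : List S) : ℕ := wordLength A.gen (A.eval w)

end InvertibleAutomaton

/-! A word over the states is trivial if and only if it fixes every letter and all its sections at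
letters are trivial. The word problem is therefore solved level by level: a list of words is kept,
each is tested on the letters and replaced by its |X| sections. Sections are shortened blockwise
(`redSec`): a finite table replaces the section of each block of `N + 1` letters by a geodesic, and
words that fit into one tape cell are looked up. One pass is linear in the cells read and written,
so the running time is governed by the depth of the recursion and by the growth of the total length
from level to level (`reaches_halt`).

If every block loses a letter in every section, long words shrink by a constant factor, the depth is
O(log n), and since each word has |X| sections the total work is polynomial. If the lengths of the
sections of a block add up to less than the block, the total length even decays geometrically, and
the work is linear. The incomplete last block causes a bounded error, which is absorbed by measuring
a word by its length minus a constant, truncated at 0 (`sum_tsub_le`, `sum_tsub_contract`).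

If these lengths add up to at most the block length, the total does not grow, and it remains to
bound the depth by O(log n). The crux is `exists_len_sec_lt`: words of some fixed length lose length
in all sections of some fixed level. Indeed, a section of full length forces the sibling sections to
be trivial, so a block keeps its length along at most one path. If a long word kept its length along
a deep path, the actions of its prefixes along that path would be compositions of actions of
finitely many blocks; by the pigeonhole principle two prefixes of different length would represent
the same element, although the longer one is geodesic. Since a block may keep its length for several
levels, the length is supplemented by a count of the levels still to come (`ageSum`); this potential
shrinks by a constant factor in every level (`potential_redSec_le`). -/

/-! ### Multi-stack machines -/

/-- An operation on a stack. -/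
inductive StackOp (Γ : Type*) where
  | keep : StackOp Γ
  | pop : StackOp Γ
  | push : Γ → StackOp Γ

/-- The effect of a stack operation; the head of the list is the top of the stack. -/
def StackOp.apply {Γ : Type*} : StackOp Γ → List Γ → List Γ
  | keep, l => l
  | pop, l => l.tail
  | push g, l => g :: l

/-- A deterministic machine with a finite control and stacks indexed by `ι`. -/
structure StackMachine (ι Q Γ : Type*) where
  start : Q
  accept : Q
  reject : Q
  δ : Q → (ι → Option Γ) → Q × (ι → StackOp Γ)

namespace StackMachine

variable {ι Q Γ : Type*} (M : StackMachine ι Q Γ)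

open Classical in
/-- One step of a stack machine, which halts in its accepting and rejecting states. -/
noncomputable def step (c : Q × (ι → List Γ)) : Q × (ι → List Γ) :=
  if c.1 = M.accept ∨ c.1 = M.reject then c
  else ((M.δ c.1 fun i => (c.2 i).head?).1,
    fun i => ((M.δ c.1 fun i => (c.2 i).head?).2 i).apply (c.2 i))

open Classical in
/-- The stack `i₀` holds `w`, all other stacks are empty. -/
noncomputable def single (i₀ : ι) (w : List Γ) : ι → List Γ :=
  Function.update (fun _ => []) i₀ w

/-! ### Simulation of stacks by Turing tapes. -/

section Compile

variable {A : Type u} {k : ℕ} {Q' Γ' : Type}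

/-- The tape that represents a stack: the head is on the top of the stack. -/
def tape (eΓ : Γ ≃ Γ') (l : List Γ) : Turing.Tape (Option Γ') :=
  Turing.Tape.mk₁ (l.map fun g => some (eΓ g))

/-- The first of the two moves that simulate a stack operation. -/
def firstMove (h : Option Γ') : StackOp Γ → Option Γ' × Option Turing.Dir
  | .keep => (h, none)
  | .pop => (none, some .right)
  | .push _ => (h, some .left)

/-- The symbol written in the second move. -/
def pending : StackOp Γ → Option Γ
  | .push g => some g
  | _ => none

theorem tape_head (eΓ : Γ ≃ Γ') (l : List Γ) : (tape eΓ l).head = l.head?.map eΓ := by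
  cases l <;> rfl

/-- A Turing machine writes before it moves. A pop fits into one move, but a push has to go left
first and write afterwards, hence the second move; `Option.or` rewrites the scanned symbol when
nothing is pending. -/
theorem tape_apply (eΓ : Γ ≃ Γ') (op : StackOp Γ) (l : List Γ) :
    MultiTapeTM.act (MultiTapeTM.act (tape eΓ l) (firstMove (tape eΓ l).head op))
      (((pending op).map eΓ).or
        (MultiTapeTM.act (tape eΓ l) (firstMove (tape eΓ l).head op)).head, none) =
      tape eΓ (op.apply l) := by
  -- A pop leaves a blank to the left of the head. It vanishes in the `ListBlank`, so the tape again
  -- has the form `mk₁`.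
  have hb : (Turing.ListBlank.mk ([] : List (Option Γ'))).cons none = Turing.ListBlank.mk [] := by
    conv_rhs => rw [← Turing.ListBlank.cons_head_tail (Turing.ListBlank.mk [])]
    rfl
  cases op with
  | keep => simp [firstMove, pending, MultiTapeTM.act, StackOp.apply]
  | pop =>
    simp only [firstMove, pending, MultiTapeTM.act, StackOp.apply, Option.map_none,
      Option.none_or, Turing.Tape.write_self]
    cases l with
    | nil =>
      simp only [tape, Turing.Tape.mk₁, Turing.Tape.mk₂, List.map_nil, List.tail_nil]
      rw [← hb, Turing.Tape.write_mk', Turing.Tape.move_right_mk']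
      simp only [Turing.ListBlank.head_cons, Turing.ListBlank.tail_cons, hb]
      rfl
    | cons g l =>
      simp only [tape, Turing.Tape.mk₁, Turing.Tape.mk₂, List.map_cons, List.tail_cons]
      rw [← Turing.ListBlank.cons_mk, Turing.Tape.write_mk', Turing.Tape.move_right_mk']
      simp [hb]
  | push g =>
    simp only [firstMove, pending, MultiTapeTM.act, StackOp.apply, Option.map_some,
      Option.some_or, Turing.Tape.write_self, tape, Turing.Tape.mk₁, Turing.Tape.mk₂,
      List.map_cons]
    rw [Turing.Tape.move_left_mk', Turing.Tape.write_mk']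
    simp

variable [Finite Q'] [Finite Γ']

/-- The Turing machine that simulates a stack machine with two moves for every step. In a state of
the second summand it remembers the symbols that are still to be written. -/
def compile (e : ι ≃ Fin (k + 1)) (eQ : Q ⊕ (Q × (ι → Option Γ)) ≃ Q') (eΓ : Γ ≃ Γ')
    (inp : A ↪ Γ) (h : M.accept ≠ M.reject) : MultiTapeTM A k where
  Q := Q'
  Γ := Γ'
  finite_Q := inferInstance
  finite_Γ := inferInstance
  inp := inp.trans eΓ.toEmbedding
  start := eQ (.inl M.start)
  accept := eQ (.inl M.accept)
  reject := eQ (.inl M.reject)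
  accept_ne_reject := by simpa using h
  δ := fun q t =>
    match eQ.symm q with
    | .inl q =>
      let r := M.δ q fun i => (t (e i)).map eΓ.symm
      (eQ (.inr (r.1, fun i => pending (r.2 i))), fun j => firstMove (t j) (r.2 (e.symm j)))
    | .inr (q, w) =>
      (eQ (.inl q), fun j => (((w (e.symm j)).map eΓ).or (t j), none))

/-- The configuration of the compiled machine that represents a configuration. -/
def encode (e : ι ≃ Fin (k + 1)) (eQ : Q ⊕ (Q × (ι → Option Γ)) ≃ Q') (eΓ : Γ ≃ Γ')
    (inp : A ↪ Γ) (h : M.accept ≠ M.reject) (c : Q × (ι → List Γ)) :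
    (M.compile e eQ eΓ inp h).Cfg where
  state := eQ (.inl c.1)
  tapes := fun j => tape eΓ (c.2 (e.symm j))

theorem compile_step_step (e : ι ≃ Fin (k + 1)) (eQ : Q ⊕ (Q × (ι → Option Γ)) ≃ Q')
    (eΓ : Γ ≃ Γ') (inp : A ↪ Γ) (h : M.accept ≠ M.reject) (c : Q × (ι → List Γ)) :
    (M.compile e eQ eΓ inp h).step ((M.compile e eQ eΓ inp h).step (M.encode e eQ eΓ inp h c)) =
      M.encode e eQ eΓ inp h (M.step c) := by
  by_cases hc : c.1 = M.accept ∨ c.1 = M.reject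
  · have : (M.compile e eQ eΓ inp h).step (M.encode e eQ eΓ inp h c) =
        M.encode e eQ eΓ inp h c := by
      rw [MultiTapeTM.step, if_pos]
      simpa [encode, compile] using hc
    rw [this, this, step, if_pos hc]
  · have h1 : (M.compile e eQ eΓ inp h).step (M.encode e eQ eΓ inp h c) =
        { state := eQ (.inr ((M.δ c.1 fun i => (c.2 i).head?).1,
            fun i => pending ((M.δ c.1 fun i => (c.2 i).head?).2 i)))
          tapes := fun j => MultiTapeTM.act (tape eΓ (c.2 (e.symm j)))
            (firstMove (tape eΓ (c.2 (e.symm j))).head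
              ((M.δ c.1 fun i => (c.2 i).head?).2 (e.symm j))) } := by
      rw [MultiTapeTM.step, if_neg]
      · simp [encode, compile, tape_head, Function.comp_def]
      · simpa [encode, compile] using hc
    rw [h1, MultiTapeTM.step, if_neg]
    · rw [step, if_neg hc]
      simp only [encode, compile, Equiv.symm_apply_apply]
      congr 1
      funext j
      exact tape_apply _ _ _
    · simp [compile]

end Compile

/-- A stack machine that decides a language can be simulated by a Turing machine. -/
theorem exists_decidesInTime [Finite Q] [Finite Γ] [Finite ι] (h : M.accept ≠ M.reject) (i₀ : ι)
    {A : Type u} (inp : A ↪ Γ) (K : Language A) (f : ℕ → ℕ)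
    (hK : ∀ w : List A,
      (w ∈ K → (M.step^[f w.length] (M.start, single i₀ (w.map inp))).1 = M.accept) ∧
      (w ∉ K → (M.step^[f w.length] (M.start, single i₀ (w.map inp))).1 = M.reject)) :
    ∃ (k : ℕ) (T : MultiTapeTM A k), T.DecidesInTime K fun n => 2 * f n := by
  obtain ⟨m, ⟨e⟩⟩ := Finite.exists_equiv_fin ι
  obtain ⟨k, rfl⟩ : ∃ k, m = k + 1 := Nat.exists_eq_succ_of_ne_zero (by
    rintro rfl; exact (e i₀).elim0)
  -- The input of a Turing machine is on tape `0`, so the input stack is swapped there.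
  obtain ⟨e, he⟩ : ∃ e : ι ≃ Fin (k + 1), e i₀ = 0 :=
    ⟨e.trans (Equiv.swap (e i₀) 0), by simp⟩
  -- Numbering states and symbols brings them from arbitrary universes down to `Type`.
  obtain ⟨a, ⟨eQ⟩⟩ := Finite.exists_equiv_fin (Q ⊕ (Q × (ι → Option Γ)))
  obtain ⟨b, ⟨eΓ⟩⟩ := Finite.exists_equiv_fin Γ
  refine ⟨k, M.compile e eQ eΓ inp h, fun w => ?_⟩
  have hinit : (M.compile e eQ eΓ inp h).init w =
      M.encode e eQ eΓ inp h (M.start, single i₀ (w.map inp)) := by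
    simp only [MultiTapeTM.init, encode]
    congr 1
    funext j
    by_cases hj : j = 0
    · subst hj
      rw [if_pos rfl, (Equiv.symm_apply_eq e).2 he.symm]
      simp only [tape, single, Function.update_self, List.map_map]
      rfl
    · have hj' : e.symm j ≠ i₀ := by
        rw [ne_eq, Equiv.symm_apply_eq, he]; exact hj
      simp [hj, single, tape, Function.update, hj']
  have hsim : ∀ (n : ℕ) (c : Q × (ι → List Γ)),
      (M.compile e eQ eΓ inp h).step^[2 * n] (M.encode e eQ eΓ inp h c) =
        M.encode e eQ eΓ inp h (M.step^[n] c) := by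
    intro n
    induction n with
    | zero => intro c; rfl
    | succ n ih =>
      intro c
      rw [Nat.mul_succ, Function.iterate_add_apply]
      change (M.compile e eQ eΓ inp h).step^[2 * n] ((M.compile e eQ eΓ inp h).step
        ((M.compile e eQ eΓ inp h).step _)) = _
      rw [compile_step_step, ih, Function.iterate_succ_apply]
  rw [hinit, hsim]
  refine ⟨fun hw => ?_, fun hw => ?_⟩
  · simp only [encode, (hK w).1 hw]; rfl
  · simp only [encode, (hK w).2 hw]; rfl

/-- The configuration `c'` is reached from `c` within `n` steps. -/
def Reaches (n : ℕ) (c c' : Q × (ι → List Γ)) : Prop := ∃ m ≤ n, M.step^[m] c = c'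

variable {M}

theorem Reaches.refl (n : ℕ) (c : Q × (ι → List Γ)) : M.Reaches n c c := ⟨0, n.zero_le, rfl⟩

theorem Reaches.trans {n n' : ℕ} {c c' c'' : Q × (ι → List Γ)} (h : M.Reaches n c c')
    (h' : M.Reaches n' c' c'') : M.Reaches (n + n') c c'' := by
  obtain ⟨m, hm, rfl⟩ := h
  obtain ⟨m', hm', rfl⟩ := h'
  exact ⟨m' + m, by omega, Function.iterate_add_apply ..⟩

theorem Reaches.mono {n n' : ℕ} {c c' : Q × (ι → List Γ)} (h : M.Reaches n c c') (hn : n ≤ n') :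
    M.Reaches n' c c' := by
  obtain ⟨m, hm, rfl⟩ := h
  exact ⟨m, hm.trans hn, rfl⟩

theorem Reaches.single {c c' : Q × (ι → List Γ)} (h : M.step c = c') : M.Reaches 1 c c' :=
  ⟨1, le_rfl, h⟩

/-- Halting configurations are fixed by `step`. This turns an upper bound for the running time into
the exact number of iterations that `DecidesInTime` asks for. -/
theorem Reaches.iterate_eq {n : ℕ} {c c' : Q × (ι → List Γ)} (h : M.Reaches n c c')
    (hc : c'.1 = M.accept ∨ c'.1 = M.reject) : M.step^[n] c = c' := by
  obtain ⟨m, hm, rfl⟩ := h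
  obtain ⟨d, rfl⟩ := Nat.exists_eq_add_of_le hm
  rw [add_comm, Function.iterate_add_apply]
  exact Function.iterate_fixed (by rw [step, if_pos hc]) d

theorem step_eq {c : Q × (ι → List Γ)} (h : c.1 ≠ M.accept) (h' : c.1 ≠ M.reject) :
    M.step c = ((M.δ c.1 fun i => (c.2 i).head?).1,
      fun i => ((M.δ c.1 fun i => (c.2 i).head?).2 i).apply (c.2 i)) := by
  rw [step, if_neg (by tauto)]

end StackMachine

namespace InvertibleAutomaton

variable {S : Type u} {X : Type v} (A : InvertibleAutomaton S X)

/-! ### Words over the states -/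

/-- The action of a word over the states on a letter. -/
def act (w : List S) (x : X) : X := w.foldl (fun x s => A.o s x) x

/-- The action of a word over the states on a word. -/
def actWord (w : List S) (v : List X) : List X := w.foldl (fun v s => A.oWord s v) v

@[simp] theorem act_nil (x : X) : A.act [] x = x := rfl

@[simp] theorem act_cons (s : S) (w : List S) (x : X) :
    A.act (s :: w) x = A.act w (A.o s x) := rfl

theorem act_append (w w' : List S) (x : X) : A.act (w ++ w') x = A.act w' (A.act w x) := by
  simp [act]

theorem act_bijective (w : List S) : Function.Bijective (A.act w) := by
  induction w with
  | nil => exact Function.bijective_id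
  | cons s w ih => exact ih.comp (A.o s).bijective

@[simp] theorem sec_nil (v : List X) : A.sec [] v = [] := rfl

@[simp] theorem length_sec (w : List S) (v : List X) : (A.sec w v).length = w.length := by
  induction w generalizing v with
  | nil => rfl
  | cons s w ih => simp [sec, ih]

theorem sec_append (w w' : List S) (v : List X) :
    A.sec (w ++ w') v = A.sec w v ++ A.sec w' (A.actWord w v) := by
  induction w generalizing v with
  | nil => rfl
  | cons s w ih => simp only [List.cons_append, sec, ih]; rfl

theorem sec_word_cons (w : List S) (x : X) (v : List X) :
    A.sec w (x :: v) = A.sec (A.sec w [x]) v := by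
  induction w generalizing x v with
  | nil => rfl
  | cons s w ih => rw [sec, sec, sec, oWord, ih (A.o s x)]; rfl

@[simp] theorem sec_word_nil (w : List S) : A.sec w [] = w := by
  induction w with
  | nil => rfl
  | cons s w ih => simp only [sec, tWord, oWord, ih]

theorem actWord_cons (w : List S) (x : X) (v : List X) :
    A.actWord w (x :: v) = A.act w x :: A.actWord (A.sec w [x]) v := by
  induction w generalizing x v with
  | nil => rfl
  | cons s w ih => exact ih _ _

@[simp] theorem actWord_word_nil (w : List S) : A.actWord w [] = [] := by
  induction w with
  | nil => rfl
  | cons s w ih => exact ih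

@[simp] theorem actWord_singleton (w : List S) (x : X) : A.actWord w [x] = [A.act w x] := by
  simp [actWord_cons]

theorem sec_append_singleton (w w' : List S) (x : X) :
    A.sec (w ++ w') [x] = A.sec w [x] ++ A.sec w' [A.act w x] := by
  simp [sec_append]

@[simp] theorem length_actWord (w : List S) (v : List X) :
    (A.actWord w v).length = v.length := by
  induction v generalizing w with
  | nil => simp
  | cons x v ih => simp [actWord_cons, ih]

/-! ### Elements represented by words -/

theorem eval_append (w w' : List S) : A.eval (w ++ w') = A.eval w * A.eval w' := by
  simp [eval]

@[simp] theorem eval_nil : A.eval [] = 1 := rfl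

theorem eval_apply (w : List S) (v : List X) :
    (A.eval w : (Equiv.Perm (List X))ᵐᵒᵖ).unop v = A.actWord w v := by
  induction w generalizing v with
  | nil => rfl
  | cons s w ih =>
    have : A.eval (s :: w) = A.gen s * A.eval w := by simp [eval]
    rw [this, Subgroup.coe_mul, MulOpposite.unop_mul, Equiv.Perm.mul_apply, ih]
    rfl

theorem eval_eq_iff {w w' : List S} :
    A.eval w = A.eval w' ↔ ∀ v, A.actWord w v = A.actWord w' v := by
  refine ⟨fun h v => by rw [← eval_apply, h, eval_apply], fun h => ?_⟩
  apply Subtype.ext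
  apply MulOpposite.unop_injective
  ext1 v
  rw [eval_apply, eval_apply, h]

theorem act_congr {w w' : List S} (h : A.eval w = A.eval w') : A.act w = A.act w' := by
  funext x
  simpa using A.eval_eq_iff.1 h [x]

theorem sec_congr {w w' : List S} (h : A.eval w = A.eval w') (v : List X) :
    A.eval (A.sec w v) = A.eval (A.sec w' v) := by
  induction v generalizing w w' with
  | nil => simpa
  | cons x v ih =>
    rw [A.sec_word_cons w, A.sec_word_cons w']
    apply ih
    rw [eval_eq_iff] at h ⊢
    intro v
    have := h (x :: v)
    rw [actWord_cons, actWord_cons] at this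
    exact (List.cons.inj this).2

/-- An element is trivial if and only if it fixes all letters and its sections are trivial. -/
theorem eval_eq_one_iff (w : List S) :
    A.eval w = 1 ↔ (∀ x, A.act w x = x) ∧ ∀ x, A.eval (A.sec w [x]) = 1 := by
  constructor
  · intro h
    rw [← A.eval_nil] at h
    exact ⟨fun x => by rw [A.act_congr h]; rfl, fun x => by rw [A.sec_congr h]; rfl⟩
  · rintro ⟨h, h'⟩
    rw [← A.eval_nil, eval_eq_iff]
    intro v
    cases v with
    | nil => simp
    | cons x v =>
      have := h' x
      rw [← A.eval_nil, eval_eq_iff] at this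
      rw [actWord_cons, this, h]
      rfl

theorem exists_eval_eq (hinv : ∀ s : S, ∃ s' : S, A.gen s' = (A.gen s)⁻¹) (g : A.group) :
    ∃ w, A.eval w = g := by
  have hg := g.2
  obtain ⟨g, hg'⟩ := g
  simp only at hg
  induction hg using Subgroup.closure_induction with
  | mem x hx =>
    obtain ⟨s, rfl⟩ := hx
    exact ⟨[s], by simp [eval]; rfl⟩
  | one => exact ⟨[], rfl⟩
  | mul x y hx hy ihx ihy =>
    obtain ⟨w, hw⟩ := ihx hx
    obtain ⟨w', hw'⟩ := ihy hy
    exact ⟨w ++ w', by rw [eval_append, hw, hw']; rfl⟩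
  | inv x hx ih =>
    obtain ⟨w, hw⟩ := ih hx
    have : ∀ w : List S, ∃ w', A.eval w' = (A.eval w)⁻¹ := by
      intro w
      induction w with
      | nil => exact ⟨[], by simp⟩
      | cons s w ih =>
        obtain ⟨w', hw'⟩ := ih
        obtain ⟨s', hs'⟩ := hinv s
        refine ⟨w' ++ [s'], ?_⟩
        rw [eval_append, hw']
        simp [eval, hs']
    obtain ⟨w', hw'⟩ := this w
    exact ⟨w', by rw [hw', hw]; rfl⟩

/-! ### Length -/

theorem len_congr {w w' : List S} (h : A.eval w = A.eval w') : A.len w = A.len w' := by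
  rw [len, h, len]

theorem exists_length_eq_len (w : List S) :
    ∃ w', w'.length = A.len w ∧ A.eval w' = A.eval w :=
  Nat.sInf_mem (s := {n | ∃ w' : List S, w'.length = n ∧ (w'.map A.gen).prod = A.eval w})
    ⟨_, w, rfl, rfl⟩

theorem len_le_length (w : List S) : A.len w ≤ w.length :=
  Nat.sInf_le ⟨w, rfl, rfl⟩

theorem len_append_le (w w' : List S) : A.len (w ++ w') ≤ A.len w + A.len w' := by
  obtain ⟨a, ha, ha'⟩ := A.exists_length_eq_len w
  obtain ⟨b, hb, hb'⟩ := A.exists_length_eq_len w'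
  rw [A.len_congr (w' := a ++ b) (by rw [eval_append, eval_append, ha', hb']), ← ha, ← hb,
    ← List.length_append]
  exact A.len_le_length _

theorem len_sec_le (w : List S) (v : List X) : A.len (A.sec w v) ≤ A.len w := by
  obtain ⟨a, ha, ha'⟩ := A.exists_length_eq_len w
  rw [A.len_congr (A.sec_congr ha'.symm v), ← ha, ← A.length_sec a v]
  exact A.len_le_length _

theorem len_eq_zero_iff (w : List S) : A.len w = 0 ↔ A.eval w = 1 := by
  constructor
  · intro h
    obtain ⟨a, ha, ha'⟩ := A.exists_length_eq_len w
    rw [h, List.length_eq_zero_iff] at ha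
    rw [← ha', ha, eval_nil]
  · intro h
    rw [A.len_congr (w' := []) (by rw [h, eval_nil])]
    simpa using A.len_le_length []

open Classical in
/-- A shortest word that represents the same element; it is the word itself where possible. -/
noncomputable def red (w : List S) : List S :=
  if A.len w = w.length then w else (A.exists_length_eq_len w).choose

@[simp] theorem length_red (w : List S) : (A.red w).length = A.len w := by
  unfold red
  split_ifs with h
  · exact h.symm
  · exact (A.exists_length_eq_len w).choose_spec.1

@[simp] theorem eval_red (w : List S) : A.eval (A.red w) = A.eval w := by
  unfold red
  split_ifs with h
  · rfl
  · exact (A.exists_length_eq_len w).choose_spec.2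

theorem red_eq_self {w : List S} (h : A.len w = w.length) : A.red w = w := if_pos h

/-! ### Reduced sections -/

/-- The section of a word at a letter, where the word is cut into blocks of `N + 1` letters and the
section of every block is replaced by a shortest representative. -/
noncomputable def redSec (N : ℕ) (w : List S) (x : X) : List S :=
  if w.length ≤ N + 1 then A.red (A.sec w [x])
  else A.red (A.sec (w.take (N + 1)) [x]) ++ redSec N (w.drop (N + 1)) (A.act (w.take (N + 1)) x)
termination_by w.length
decreasing_by simp; omega

theorem redSec_of_le {N : ℕ} {w : List S} (h : w.length ≤ N + 1) (x : X) :
    A.redSec N w x = A.red (A.sec w [x]) := by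
  rw [redSec, if_pos h]

theorem redSec_append {N : ℕ} {b : List S} (hb : b.length = N + 1) (w : List S) (x : X) :
    A.redSec N (b ++ w) x = A.red (A.sec b [x]) ++ A.redSec N w (A.act b x) := by
  by_cases hw : w = []
  · subst hw
    have h0 : A.red [] = ([] : List S) := A.red_eq_self (by simpa using A.len_le_length [])
    rw [List.append_nil, redSec_of_le _ hb.le, redSec_of_le _ (by simp), sec_nil, h0,
      List.append_nil]
  · have := List.length_pos_iff.2 hw
    rw [redSec, if_neg (by simp; omega)]
    simp [← hb]

/-- Induction along the blocks of `N + 1` letters of a word. -/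
theorem blockInduction (N : ℕ) {P : List S → Prop} (h : ∀ w, w.length ≤ N → P w)
    (h' : ∀ b w, b.length = N + 1 → P w → P (b ++ w)) (w : List S) : P w := by
  induction hn : w.length using Nat.strong_induction_on generalizing w with
  | _ n ih =>
    by_cases hw : w.length ≤ N
    · exact h w hw
    · rw [← List.take_append_drop (N + 1) w]
      apply h'
      · simp; omega
      · exact ih _ (by simp; omega) _ rfl

theorem eval_redSec (N : ℕ) (w : List S) (x : X) :
    A.eval (A.redSec N w x) = A.eval (A.sec w [x]) := by
  induction w using blockInduction N generalizing x with
  | h w hw => rw [redSec_of_le _ (by omega), eval_red]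
  | h' b w hb ih => rw [redSec_append _ hb, eval_append, eval_red, ih, ← eval_append,
      sec_append_singleton]

theorem length_redSec_le (N : ℕ) (w : List S) (x : X) :
    (A.redSec N w x).length ≤ w.length := by
  have key : ∀ (w : List S) x, (A.red (A.sec w [x])).length ≤ w.length := fun w x => by
    simpa using A.len_le_length (A.sec w [x])
  induction w using blockInduction N generalizing x with
  | h w hw => rw [redSec_of_le _ (by omega)]; exact key w x
  | h' b w hb ih =>
    rw [redSec_append _ hb, List.length_append, List.length_append]
    exact add_le_add (key b x) (ih _)

/-- Blocks are cut from the left, so a prefix of complete blocks does not affect the cutting of the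
rest. With cells of `B` letters and `N + 1 ∣ B`, reduced sections can thus be computed cell by cell.
-/
theorem redSec_append_of_dvd {N : ℕ} {b : List S} (hb : N + 1 ∣ b.length) (w : List S) (x : X) :
    A.redSec N (b ++ w) x = A.redSec N b x ++ A.redSec N w (A.act b x) := by
  induction b using blockInduction N generalizing x with
  | h b hb' =>
    have : b = [] := List.length_eq_zero_iff.1 (Nat.eq_zero_of_dvd_of_lt hb (by omega))
    subst this
    have h0 : A.red [] = ([] : List S) := A.red_eq_self (by simpa using A.len_le_length [])
    simp [redSec_of_le, h0]
  | h' b w' hb' ih =>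
    rw [List.append_assoc, redSec_append _ hb', redSec_append _ hb', ih, List.append_assoc,
      act_append]
    simpa [hb'] using hb

end InvertibleAutomaton

/-! ### Words stored in cells -/

/-- A tape symbol: a word of at most `B` letters, and a mark that is set on the last cell of a
word. -/
abbrev Cell (S : Type u) (B : ℕ) : Type u := {l : List S // l.length ≤ B} × Bool

namespace Cell

variable {S : Type u} {B : ℕ}

/-- The cell that holds the first `B` letters of a word. -/
def mk (B : ℕ) (l : List S) (e : Bool) : Cell S B := (⟨l.take B, by simp⟩, e)

theorem mk_val {l : List S} (h : l.length ≤ B) (e : Bool) : (mk B l e).1.1 = l :=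
  List.take_of_length_le h

@[simp] theorem mk_snd (l : List S) (e : Bool) : (mk B l e).2 = e := rfl

/-- Add a word to the last cell (`p` if there is one) of a sequence of cells. The result is the
next-to-last cell, if a new one has been completed, and the last cell. -/
def combine (p : Option (Cell S B)) (g : Cell S B) : Option (Cell S B) × Cell S B :=
  match p with
  | none => (none, g)
  | some (c, true) => (some (c, true), g)
  | some (c, false) =>
    if (c.1 ++ g.1.1).length ≤ B then (none, mk B (c.1 ++ g.1.1) g.2)
    else (some (mk B (c.1 ++ g.1.1) false), mk B ((c.1 ++ g.1.1).drop B) g.2)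

/-- Add a word to a stack of cells. -/
def pushOn (R : List (Cell S B)) (g : Cell S B) : List (Cell S B) :=
  (combine R.head? g).2 :: ((combine R.head? g).1.toList ++ R.tail)

/-- A stack of cells is closed if its top is the last cell of a word. -/
def Closed (R : List (Cell S B)) : Prop := ∀ g ∈ R.head?, g.2 = true

/-- A word as a sequence of cells, of which the last has the mark `e`. -/
def enc (B : ℕ) [NeZero B] (e : Bool) (y : List S) : List (Cell S B) :=
  if y.length ≤ B then [mk B y e] else mk B y false :: enc B e (y.drop B)
termination_by y.length
decreasing_by have := NeZero.pos B; simp; omega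

variable [NeZero B]

theorem enc_of_le {y : List S} (h : y.length ≤ B) (e : Bool) : enc B e y = [mk B y e] := by
  rw [enc, if_pos h]

theorem enc_of_lt {y : List S} (h : B < y.length) (e : Bool) :
    enc B e y = mk B y false :: enc B e (y.drop B) := by
  rw [enc, if_neg (by omega)]

/-- Induction along the cells of a word. -/
theorem induction {P : List S → Prop} (h : ∀ y, y.length ≤ B → P y)
    (h' : ∀ y, B < y.length → P (y.drop B) → P y) (y : List S) : P y := by
  have := NeZero.pos B
  induction hn : y.length using Nat.strong_induction_on generalizing y with
  | _ n ih =>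
    by_cases hy : y.length ≤ B
    · exact h y hy
    · exact h' y (by omega) (ih _ (by simp; omega) _ rfl)

theorem length_enc_le (e : Bool) (y : List S) : (enc B e y).length ≤ y.length + 1 := by
  have := NeZero.pos B
  induction y using induction (B := B) with
  | h y hy => simp [enc_of_le hy]
  | h' y hy ih =>
    rw [enc_of_lt hy, List.length_cons]
    simp at ih
    omega

theorem enc_ne_nil (e : Bool) (y : List S) : enc B e y ≠ [] := by
  rw [enc]; split_ifs <;> simp

/-- The last cell of a word, and the others. -/
theorem exists_enc_reverse (y : List S) :
    ∃ (c : {l : List S // l.length ≤ B}) (t : List (Cell S B)),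
      ∀ e, (enc B e y).reverse = (c, e) :: t := by
  induction y using induction (B := B) with
  | h y hy => exact ⟨⟨y, hy⟩, [], fun e => by simp [enc_of_le hy, mk, List.take_of_length_le hy]⟩
  | h' y hy ih =>
    obtain ⟨c, t, h⟩ := ih
    exact ⟨c, t ++ [mk B y false], fun e => by simp [enc_of_lt hy, h]⟩

theorem closed_enc (y : List S) (R : List (Cell S B)) :
    Closed ((enc B true y).reverse ++ R) := by
  obtain ⟨c, t, h⟩ := exists_enc_reverse (B := B) y
  rw [h]
  rintro g hg
  simp at hg
  rw [← hg]

theorem pushOn_closed {R : List (Cell S B)} (hR : Closed R) {z : List S} (hz : z.length ≤ B)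
    (e : Bool) : pushOn R (mk B z e) = (enc B e z).reverse ++ R := by
  rw [enc_of_le hz]
  cases R with
  | nil => rfl
  | cons g R =>
    obtain ⟨c, m⟩ := g
    have : m = true := hR _ rfl
    subst this
    simp [pushOn, combine]

/-- Only the top cell can be incomplete, and at most `B` new letters complete at most one cell. So
the shortened output is repacked into full cells with bounded memory. -/
theorem pushOn_enc (y : List S) (R : List (Cell S B)) {z : List S} (hz : z.length ≤ B)
    (e : Bool) :
    pushOn ((enc B false y).reverse ++ R) (mk B z e) = (enc B e (y ++ z)).reverse ++ R := by
  have := NeZero.pos B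
  induction y using induction (B := B) generalizing R with
  | h y hy =>
    rw [enc_of_le hy]
    simp only [List.reverse_cons, List.reverse_nil, List.nil_append, List.singleton_append, pushOn,
      List.head?_cons, List.tail_cons]
    simp only [combine, mk, List.take_of_length_le hy, List.take_of_length_le hz]
    by_cases h : (y ++ z).length ≤ B
    · rw [enc_of_le h, if_pos h]
      simp [mk]
    · rw [enc_of_lt (by omega), if_neg h, enc_of_le (by simp; omega)]
      simp [mk]
  | h' y hy ih =>
    rw [enc_of_lt hy, List.reverse_cons, List.append_assoc, ih,
      enc_of_lt (y := y ++ z) (by simp; omega), List.drop_append_of_le_length hy.le]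
    simp [mk, List.take_append_of_le_length hy.le]

end Cell

/-! ### The machine that solves the word problem -/

namespace WordProblemMachine

variable {S : Type u} {X : Type v}

/-- The stack `none` holds `a`, the others are given by `R`. -/
def stk {Γ : Type*} (a : List Γ) (R : X → List Γ) : Option X → List Γ :=
  fun i => i.elim a R

@[simp] theorem stk_none {Γ : Type*} (a : List Γ) (R : X → List Γ) : stk a R none = a := rfl

@[simp] theorem stk_some {Γ : Type*} (a : List Γ) (R : X → List Γ) (x : X) :
    stk a R (some x) = R x := rfl

variable [Fintype X]

/-- The states of the machine. It reads words (the flag tells if it is inside a word, the first map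
is the action of the part that has been read, the second map gives the cells that are about to be
written), it copies the stacks indexed by a list of letters, or it has halted. -/
inductive State (S : Type u) (X : Type v) [Fintype X] (B : ℕ) : Type (max u v)
  | read (b : Bool) (σ : X → X) (p : X → Option (Cell S B))
  | copy (l : {l : List X // l.length ≤ Fintype.card X})
  | accept
  | reject

instance finite_cell [Finite S] (B : ℕ) : Finite (Cell S B) := by
  have : Finite {l : List S // l.length ≤ B} := (List.finite_length_le S B).to_subtype
  infer_instance

instance [Finite S] (B : ℕ) : Finite (State S X B) := by
  have : Finite {l : List X // l.length ≤ Fintype.card X} :=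
    (List.finite_length_le X _).to_subtype
  let f : (Bool × (X → X) × (X → Option (Cell S B))) ⊕
      ({l : List X // l.length ≤ Fintype.card X} ⊕ Bool) → State S X B
    | .inl (b, σ, p) => .read b σ p
    | .inr (.inl l) => .copy l
    | .inr (.inr true) => .accept
    | .inr (.inr false) => .reject
  refine Finite.of_surjective f ?_
  rintro (⟨b, σ, p⟩ | l | _ | _)
  exacts [⟨.inl (b, σ, p), rfl⟩, ⟨.inr (.inl l), rfl⟩, ⟨.inr (.inr true), rfl⟩,
    ⟨.inr (.inr false), rfl⟩]

/-- Push the content, if there is any. -/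
def pushOption {Γ : Type*} : Option Γ → StackOp Γ
  | none => .keep
  | some g => .push g

@[simp] theorem pushOption_apply {Γ : Type*} (o : Option Γ) (l : List Γ) :
    (pushOption o).apply l = o.toList ++ l := by
  cases o <;> rfl

variable (A : InvertibleAutomaton S X) (N B : ℕ)

open Classical in
/-- The machine for the word problem. The stack `none` holds a list of words. In one pass the
sections of these words at all letters are computed on the stacks `some x`; words of at most `B`
letters are looked up. -/
noncomputable def machine : StackMachine (Option X) (State S X B) (Cell S B) where
  start := .read false id fun _ => none
  accept := .accept
  reject := .reject
  δ := fun q top =>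
    match q with
    | .read b σ p =>
      match top none with
      | some (c, e) =>
        -- A marked cell outside a word is a whole word; its triviality is stored in the finite
        -- control.
        if b = false ∧ e = true then
          if A.eval c.1 = 1 then (.read false σ p, fun i => i.elim .pop fun _ => .keep)
          else (.reject, fun _ => .keep)
        else if e = true ∧ ∃ x, A.act c.1 (σ x) ≠ x then (.reject, fun _ => .keep)
        else
          (.read (!e) (if e then id else fun x => A.act c.1 (σ x)) fun x =>
              some (Cell.combine (p x) (Cell.mk B (A.redSec N c.1 (σ x)) e)).2,
            fun i => i.elim .pop fun x =>
              pushOption (Cell.combine (p x) (Cell.mk B (A.redSec N c.1 (σ x)) e)).1)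
      | none =>
        if b = true ∧ ∃ x, σ x ≠ x then (.reject, fun _ => .keep)
        -- The mark closes words that are still open. This matters only in the first pass, because
        -- the input letters carry no mark.
        else (.copy ⟨Finset.univ.toList, by simp⟩,
          fun i => i.elim .keep fun x => pushOption ((p x).map fun g => (g.1, true)))
    | .copy ⟨[], _⟩ =>
      match top none with
      | none => (.accept, fun _ => .keep)
      | some _ => (.read false id fun _ => none, fun _ => .keep)
    | .copy ⟨x :: l, h⟩ =>
      match top (some x) with
      | none => (.copy ⟨l, Nat.le_of_succ_le h⟩, fun _ => .keep)
      | some g => (.copy ⟨x :: l, h⟩,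
          fun i => i.elim (.push g) fun y => if y = x then .pop else .keep)
    | .accept => (.accept, fun _ => .keep)
    | .reject => (.reject, fun _ => .keep)

variable {A N B}

/-- The configuration when the cells `a` are to be read and the cells `R` have been computed. -/
def reading (b : Bool) (σ : X → X) (R : X → List (Cell S B)) (a : List (Cell S B)) :
    State S X B × (Option X → List (Cell S B)) :=
  -- The top of each output stack is held in the control, since it may still have to be filled up.
  (.read b σ fun x => (R x).head?, stk a fun x => (R x).tail)

theorem step_reading {b : Bool} (σ : X → X) (R : X → List (Cell S B)) (c : Cell S B)
    (a : List (Cell S B)) (h : ¬ (b = false ∧ c.2 = true))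
    (h' : c.2 = true → ∀ x, A.act c.1.1 (σ x) = x) :
    (machine A N B).step (reading b σ R (c :: a)) =
      reading (!c.2) (if c.2 then id else fun x => A.act c.1.1 (σ x))
        (fun x => Cell.pushOn (R x) (Cell.mk B (A.redSec N c.1.1 (σ x)) c.2)) a := by
  obtain ⟨c, e⟩ := c
  have h'' : ¬ (e = true ∧ ∃ x, A.act c.1 (σ x) ≠ x) := by
    rintro ⟨h1, x, hx⟩; exact hx (h' h1 x)
  rw [StackMachine.step_eq (by simp [reading, machine]) (by simp [reading, machine])]
  simp only [reading, machine, stk_none, List.head?_cons, if_neg h, if_neg h'']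
  refine Prod.ext rfl ?_
  funext i
  cases i with
  | none => rfl
  | some x => simp [Cell.pushOn]

theorem step_reading_reject {b : Bool} (σ : X → X) (R : X → List (Cell S B)) (c : Cell S B)
    (a : List (Cell S B)) (h : b = true) (h' : c.2 = true) (hx : ∃ x, A.act c.1.1 (σ x) ≠ x) :
    ((machine A N B).step (reading b σ R (c :: a))).1 = .reject := by
  obtain ⟨c, e⟩ := c
  rw [StackMachine.step_eq (by simp [reading, machine]) (by simp [reading, machine])]
  simp only at h'
  simp only [reading, machine, stk_none, List.head?_cons, h, h', hx]
  simp

theorem step_reading_short (σ : X → X) (R : X → List (Cell S B)) (c : Cell S B)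
    (a : List (Cell S B)) (h : c.2 = true) (hc : A.eval c.1.1 = 1) :
    (machine A N B).step (reading false σ R (c :: a)) = reading false σ R a := by
  obtain ⟨c, e⟩ := c
  rw [StackMachine.step_eq (by simp [reading, machine]) (by simp [reading, machine])]
  simp only at h
  simp only at hc
  simp only [reading, machine, stk_none, List.head?_cons, h, hc]
  refine Prod.ext (by simp) ?_
  funext i
  cases i with
  | none => simp [StackOp.apply]
  | some x => simp [StackOp.apply]

theorem step_reading_short_reject (σ : X → X) (R : X → List (Cell S B)) (c : Cell S B)
    (a : List (Cell S B)) (h : c.2 = true) (hc : A.eval c.1.1 ≠ 1) :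
    ((machine A N B).step (reading false σ R (c :: a))).1 = .reject := by
  obtain ⟨c, e⟩ := c
  rw [StackMachine.step_eq (by simp [reading, machine]) (by simp [reading, machine])]
  simp only at h
  simp only at hc
  simp only [reading, machine, stk_none, List.head?_cons, h, hc]
  simp

theorem step_reading_nil {b : Bool} (σ : X → X) (R : X → List (Cell S B))
    (h : b = true → ∀ x, σ x = x) :
    (machine A N B).step (reading b σ R []) =
      (.copy ⟨Finset.univ.toList, by simp⟩,
        stk [] fun x => ((R x).head?.map fun g => (g.1, true)).toList ++ (R x).tail) := by
  have h' : ¬ (b = true ∧ ∃ x, σ x ≠ x) := by rintro ⟨h1, x, hx⟩; exact hx (h h1 x)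
  rw [StackMachine.step_eq (by simp [reading, machine]) (by simp [reading, machine])]
  simp only [reading, machine, stk_none, List.head?_nil, if_neg h']
  refine Prod.ext rfl ?_
  funext i
  cases i with
  | none => simp [StackOp.apply]
  | some x => simp

theorem step_reading_nil_reject {b : Bool} (σ : X → X) (R : X → List (Cell S B))
    (hb : b = true) (h : ∃ x, σ x ≠ x) :
    ((machine A N B).step (reading b σ R [])).1 = .reject := by
  rw [StackMachine.step_eq (by simp [reading, machine]) (by simp [reading, machine])]
  simp [reading, machine, stk, hb, h]

/-- Moving the cells to another stack reverses them, which undoes the reversal caused by writing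
them. -/
theorem reaches_copy_cons (x : X) (l : List X) (h : (x :: l).length ≤ Fintype.card X)
    (a : List (Cell S B)) (R : X → List (Cell S B)) (r : List (Cell S B)) (hr : R x = r) :
    open Classical in
    (machine A N B).Reaches (r.length + 1) (.copy ⟨x :: l, h⟩, stk a R)
      (.copy ⟨l, Nat.le_of_succ_le h⟩, stk (r.reverse ++ a) (Function.update R x [])) := by
  classical
  induction r generalizing a R with
  | nil =>
    apply StackMachine.Reaches.single
    rw [StackMachine.step_eq (by simp [machine]) (by simp [machine])]
    simp only [machine, stk_some, hr, List.head?_nil]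
    refine Prod.ext rfl ?_
    funext i
    cases i with
    | none => simp [StackOp.apply]
    | some y =>
      by_cases hy : y = x
      · subst hy; simp [StackOp.apply, hr]
      · simp [StackOp.apply, Function.update, hy]
  | cons g r ih =>
    have hs : (machine A N B).step (.copy ⟨x :: l, h⟩, stk a R) =
        (.copy ⟨x :: l, h⟩, stk (g :: a) (Function.update R x r)) := by
      rw [StackMachine.step_eq (by simp [machine]) (by simp [machine])]
      simp only [machine, stk_some, hr, List.head?_cons]
      refine Prod.ext rfl ?_
      funext i
      cases i with
      | none => simp [StackOp.apply]
      | some y =>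
        by_cases hy : y = x
        · subst hy; simp [StackOp.apply, hr]
        · simp [StackOp.apply, Function.update, hy]
    have := (StackMachine.Reaches.single hs).trans
      (ih (g :: a) (Function.update R x r) (by simp))
    rw [Function.update_idem] at this
    simpa [add_comm, add_assoc, add_left_comm] using this

theorem reaches_copy (l : List X) (h : l.length ≤ Fintype.card X) (hl : l.Nodup)
    (a : List (Cell S B)) (R : X → List (Cell S B)) (hR : ∀ x ∉ l, R x = []) :
    (machine A N B).Reaches ((l.map fun x => (R x).length).sum + l.length)
      (.copy ⟨l, h⟩, stk a R)
      (.copy ⟨[], by simp⟩,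
        stk ((l.reverse.flatMap fun x => (R x).reverse) ++ a) fun _ => []) := by
  classical
  induction l generalizing a R with
  | nil =>
    have : R = fun _ => [] := funext fun x => hR x (by simp)
    subst this
    exact StackMachine.Reaches.refl _ _
  | cons x l ih =>
    have hx : x ∉ l := (List.nodup_cons.1 hl).1
    have h1 := reaches_copy_cons (A := A) (N := N) x l h a R _ rfl
    have h2 := ih (Nat.le_of_succ_le h) (List.nodup_cons.1 hl).2 ((R x).reverse ++ a)
      (Function.update R x []) (fun y hy => by
        by_cases hyx : y = x
        · subst hyx; simp
        · rw [Function.update_of_ne hyx]; exact hR y (by simp [hyx, hy]))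
    have h3 : ∀ y ∈ l, Function.update R x [] y = R y := fun y hy =>
      Function.update_of_ne (fun hyx : y = x => hx (hyx ▸ hy)) _ _
    have h4 : (l.map fun y => (Function.update R x [] y).length) = l.map fun y => (R y).length :=
      List.map_congr_left fun y hy => by rw [h3 y hy]
    have h5 : (l.reverse.flatMap fun y => (Function.update R x [] y).reverse) =
        l.reverse.flatMap fun y => (R y).reverse := by
      apply List.flatMap_congr
      intro y hy
      rw [h3 y (List.mem_reverse.1 hy)]
    rw [h4, h5] at h2
    have := h1.trans h2
    simp only [List.map_cons, List.sum_cons, List.length_cons, List.reverse_cons,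
      List.flatMap_append, List.flatMap_cons, List.flatMap_nil, List.append_nil,
      List.append_assoc]
    exact this.mono (by omega)

theorem step_copy_nil (h : ([] : List X).length ≤ Fintype.card X) (R : X → List (Cell S B)) :
    ((machine A N B).step (.copy ⟨[], h⟩, stk [] R)).1 = .accept := by
  rw [StackMachine.step_eq (by simp [machine]) (by simp [machine])]
  simp [machine, stk]

theorem step_copy_nil' (h : ([] : List X).length ≤ Fintype.card X) {a : List (Cell S B)}
    (ha : a ≠ []) :
    (machine A N B).step (.copy ⟨[], h⟩, stk a fun _ => []) =
      reading false id (fun _ => []) a := by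
  obtain ⟨g, a, rfl⟩ := List.exists_cons_of_ne_nil ha
  rw [StackMachine.step_eq (by simp [machine]) (by simp [machine])]
  rfl

end WordProblemMachine

/-! ### Correctness of a pass of the machine. -/

namespace WordProblemMachine

variable {S : Type u} {X : Type v} [Fintype X] {A : InvertibleAutomaton S X} {N B : ℕ} [NeZero B]

open Cell

theorem length_redSec_le_of_le {S : Type u} {X : Type v} {A : InvertibleAutomaton S X} {N B : ℕ}
    {w : List S} (hw : w.length ≤ B) (x : X) :
    (A.redSec N w x).length ≤ B := (A.length_redSec_le N w x).trans hw

/-- Reading the rest of a word. -/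
theorem reaches_rest (hB : N + 1 ∣ B) (w : List S) (σ : X → X) (out : X → List S)
    (R : X → List (Cell S B)) (a : List (Cell S B)) :
    ((∀ x, A.act w (σ x) = x) ∧
      (machine A N B).Reaches (enc B true w).length
        (reading true σ (fun x => (enc B false (out x)).reverse ++ R x) (enc B true w ++ a))
        (reading false id
          (fun x => (enc B true (out x ++ A.redSec N w (σ x))).reverse ++ R x) a)) ∨
    ((∃ x, A.act w (σ x) ≠ x) ∧ ∃ c, c.1 = .reject ∧
      (machine A N B).Reaches (enc B true w).length
        (reading true σ (fun x => (enc B false (out x)).reverse ++ R x) (enc B true w ++ a)) c) := by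
  induction w using Cell.induction (B := B) generalizing σ out with
  | h w hw =>
    rw [enc_of_le hw]
    have hv := mk_val hw true
    have hs := fun x => length_redSec_le_of_le (A := A) (N := N) hw (σ x)
    by_cases h : ∀ x, A.act w (σ x) = x
    · left
      refine ⟨h, StackMachine.Reaches.single ?_⟩
      rw [List.singleton_append, step_reading]
      · simp only [hv, pushOn_enc _ _ (hs _), mk_snd]
        rfl
      · simp
      · rw [hv]; exact fun _ => h
    · right
      push Not at h
      refine ⟨h, _, ?_, StackMachine.Reaches.single rfl⟩
      exact step_reading_reject _ _ _ _ rfl rfl (by rw [hv]; exact h)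
  | h' w hw ih =>
    rw [enc_of_lt hw]
    have hlen : (w.take B).length = B := by simp; omega
    have hv : (mk B w false).1.1 = w.take B := rfl
    have hs := fun x => length_redSec_le_of_le (A := A) (N := N) hlen.le (σ x)
    have hact : ∀ x, A.act w (σ x) = A.act (w.drop B) (A.act (w.take B) (σ x)) := fun x => by
      rw [← A.act_append, List.take_append_drop]
    -- The divisibility of `B` enters here: the boundary of a cell is a boundary of blocks.
    have hred : ∀ x, A.redSec N w (σ x) = A.redSec N (w.take B) (σ x) ++
        A.redSec N (w.drop B) (A.act (w.take B) (σ x)) := fun x => by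
      rw [← A.redSec_append_of_dvd (by rwa [hlen]), List.take_append_drop]
    have h1 : (machine A N B).Reaches 1
        (reading true σ (fun x => (enc B false (out x)).reverse ++ R x)
          (mk B w false :: enc B true (w.drop B) ++ a))
        (reading true (fun x => A.act (w.take B) (σ x))
          (fun x => (enc B false (out x ++ A.redSec N (w.take B) (σ x))).reverse ++ R x)
          (enc B true (w.drop B) ++ a)) := by
      apply StackMachine.Reaches.single
      rw [List.cons_append, step_reading]
      · simp only [hv, pushOn_enc _ _ (hs _), mk_snd]
        rfl
      · simp
      · simp [mk]
    simp only [hact, hred, List.length_cons]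
    rcases ih (fun x => A.act (w.take B) (σ x)) (fun x => out x ++ A.redSec N (w.take B) (σ x))
      with ⟨h, h2⟩ | ⟨h, c, hc, h2⟩
    · left
      refine ⟨h, ?_⟩
      simp only [List.append_assoc] at h1 h2 ⊢
      exact (h1.trans h2).mono (by omega)
    · right
      exact ⟨h, c, hc, (h1.trans h2).mono (by omega)⟩

/-- Reading a word that does not fit into a cell. -/
theorem reaches_word (hB : N + 1 ∣ B) (w : List S) (hw : B < w.length)
    (R : X → List (Cell S B)) (hR : ∀ x, Closed (R x)) (a : List (Cell S B)) :
    ((∀ x, A.act w x = x) ∧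
      (machine A N B).Reaches (enc B true w).length
        (reading false id R (enc B true w ++ a))
        (reading false id (fun x => (enc B true (A.redSec N w x)).reverse ++ R x) a)) ∨
    ((∃ x, A.act w x ≠ x) ∧ ∃ c, c.1 = .reject ∧
      (machine A N B).Reaches (enc B true w).length
        (reading false id R (enc B true w ++ a)) c) := by
  rw [enc_of_lt hw]
  have hlen : (w.take B).length = B := by simp; omega
  have hv : (mk B w false).1.1 = w.take B := rfl
  have hs := fun x => length_redSec_le_of_le (A := A) (N := N) hlen.le x
  have hact : ∀ x, A.act w x = A.act (w.drop B) (A.act (w.take B) x) := fun x => by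
    rw [← A.act_append, List.take_append_drop]
  have hred : ∀ x, A.redSec N w x = A.redSec N (w.take B) x ++
      A.redSec N (w.drop B) (A.act (w.take B) x) := fun x => by
    rw [← A.redSec_append_of_dvd (by rwa [hlen]), List.take_append_drop]
  have h1 : (machine A N B).Reaches 1
      (reading false id R (mk B w false :: enc B true (w.drop B) ++ a))
      (reading true (fun x => A.act (w.take B) x)
        (fun x => (enc B false (A.redSec N (w.take B) x)).reverse ++ R x)
        (enc B true (w.drop B) ++ a)) := by
    apply StackMachine.Reaches.single
    rw [List.cons_append, step_reading]
    · simp only [hv, id, pushOn_closed (hR _) (hs _), mk_snd]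
      rfl
    · simp [mk]
    · simp [mk]
  simp only [hact, hred, List.length_cons]
  rcases reaches_rest hB (w.drop B) (A.act (w.take B)) (fun x => A.redSec N (w.take B) x) R a
    with ⟨h, h2⟩ | ⟨h, c, hc, h2⟩
  · exact .inl ⟨h, (h1.trans h2).mono (by omega)⟩
  · exact .inr ⟨h, c, hc, (h1.trans h2).mono (by omega)⟩

open Classical in
/-- The reduced sections at `x` of those words that do not fit into a cell. -/
noncomputable def sections (A : InvertibleAutomaton S X) (N B : ℕ) (ws : List (List S)) (x : X) :
    List (List S) :=
  (ws.filter fun w => B < w.length).map fun w => A.redSec N w x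

/-- Reading a list of words. -/
theorem reaches_words (hB : N + 1 ∣ B) (ws : List (List S))
    (R : X → List (Cell S B)) (hR : ∀ x, Closed (R x)) :
    ((∀ w ∈ ws, (w.length ≤ B → A.eval w = 1) ∧ (B < w.length → ∀ x, A.act w x = x)) ∧
      (machine A N B).Reaches (ws.flatMap (enc B true)).length
        (reading false id R (ws.flatMap (enc B true)))
        (reading false id
          (fun x => ((sections A N B ws x).flatMap (enc B true)).reverse ++ R x) [])) ∨
    ((∃ w ∈ ws, A.eval w ≠ 1) ∧ ∃ c, c.1 = .reject ∧
      (machine A N B).Reaches (ws.flatMap (enc B true)).length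
        (reading false id R (ws.flatMap (enc B true))) c) := by
  induction ws generalizing R with
  | nil => left; exact ⟨by simp, by simpa [sections] using StackMachine.Reaches.refl _ _⟩
  | cons w ws ih =>
    rw [List.flatMap_cons, List.length_append]
    by_cases hw : w.length ≤ B
    · have hv := mk_val hw true
      have hsec : ∀ x, sections A N B (w :: ws) x = sections A N B ws x := fun x => by
        rw [sections, List.filter_cons_of_neg (by simpa using hw), sections]
      simp only [hsec]
      rw [enc_of_le hw, List.singleton_append]
      by_cases h1 : A.eval w = 1
      · have := StackMachine.Reaches.single (step_reading_short (N := N) id R (mk B w true)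
          (ws.flatMap (enc B true)) rfl (by rw [hv]; exact h1))
        rcases ih R hR with ⟨h, h2⟩ | ⟨⟨w', hw', h⟩, c, hc, h2⟩
        · left
          refine ⟨?_, this.trans h2⟩
          intro w' hw'
          rcases List.mem_cons.1 hw' with rfl | hw'
          · exact ⟨fun _ => h1, fun h => by omega⟩
          · exact h w' hw'
        · right
          exact ⟨⟨w', by simp [hw'], h⟩, c, hc, this.trans h2⟩
      · right
        refine ⟨⟨w, by simp, h1⟩, _, ?_, (StackMachine.Reaches.single rfl).mono
          (Nat.le_add_right 1 _)⟩
        exact step_reading_short_reject id R _ _ rfl (by rw [hv]; exact h1)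
    · push Not at hw
      have hsec : ∀ x, sections A N B (w :: ws) x = A.redSec N w x :: sections A N B ws x :=
        fun x => by
        rw [sections, List.filter_cons_of_pos (by simpa using hw), List.map_cons, sections]
      simp only [hsec, List.flatMap_cons, List.reverse_append, List.append_assoc]
      rcases reaches_word (A := A) hB w hw R hR (ws.flatMap (enc B true))
        with ⟨h1, h2⟩ | ⟨⟨x, hx⟩, c, hc, h2⟩
      · rcases ih (fun x => (enc B true (A.redSec N w x)).reverse ++ R x)
          (fun x => closed_enc _ _) with ⟨h, h3⟩ | ⟨⟨w', hw', h⟩, c, hc, h3⟩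
        · left
          refine ⟨?_, h2.trans h3⟩
          intro w' hw'
          rcases List.mem_cons.1 hw' with rfl | hw'
          · exact ⟨fun h => by omega, fun _ => h1⟩
          · exact h w' hw'
        · right
          exact ⟨⟨w', by simp [hw'], h⟩, c, hc, h2.trans h3⟩
      · right
        refine ⟨⟨w, by simp, fun h => ?_⟩, c, hc, h2.mono (by omega)⟩
        exact hx (((A.eval_eq_one_iff w).1 h).1 x)

/-- The words of the next level, in the order in which they are copied. -/
noncomputable def gather (out : X → List (List S)) : List (List S) :=
  (Finset.univ : Finset X).toList.reverse.flatMap out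

/-- Copying after a pass, and the decision between halting and a further pass. -/
theorem reaches_next (out : X → List (List S)) (R : X → List (Cell S B))
    (hR : ∀ x, R x = ((out x).flatMap (enc B true)).reverse) :
    ∃ c, (machine A N B).Reaches
        (((gather out).flatMap (enc B true)).length + Fintype.card X + 1)
        (.copy ⟨Finset.univ.toList, by simp⟩, stk [] R) c ∧
      (gather out = [] → c.1 = .accept) ∧
      (gather out ≠ [] → c = reading false id (fun _ => []) ((gather out).flatMap (enc B true))) := by
  have h := reaches_copy (A := A) (N := N) (B := B) Finset.univ.toList (by simp)
    (Finset.nodup_toList _) [] R (by simp)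
  have hg : ((Finset.univ : Finset X).toList.reverse.flatMap fun x => (R x).reverse) ++ [] =
      (gather out).flatMap (enc B true) := by
    simp only [hR, gather, List.reverse_reverse, List.append_nil, List.flatMap_assoc]
  have hl : ((Finset.univ : Finset X).toList.map fun x => (R x).length).sum =
      ((gather out).flatMap (enc B true)).length := by
    rw [← hg]
    simp [List.length_flatMap]
  rw [hg, hl] at h
  refine ⟨_, StackMachine.Reaches.trans (h.mono (by simp)) (StackMachine.Reaches.single rfl),
    fun h0 => ?_, fun h0 => ?_⟩
  · rw [h0]; exact step_copy_nil _ _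
  · apply step_copy_nil'
    obtain ⟨w, l, hw⟩ := List.exists_cons_of_ne_nil h0
    rw [hw, List.flatMap_cons]
    simp [enc_ne_nil]

/-- One pass over a list of words. -/
theorem reaches_level (hB : N + 1 ∣ B) (ws : List (List S)) :
    ∃ c, (machine A N B).Reaches
        ((ws.flatMap (enc B true)).length +
          ((gather (sections A N B ws)).flatMap (enc B true)).length + Fintype.card X + 2)
        (reading false id (fun _ => []) (ws.flatMap (enc B true))) c ∧
      ((c.1 = .reject ∧ ∃ w ∈ ws, A.eval w ≠ 1) ∨
        (((∀ w ∈ gather (sections A N B ws), A.eval w = 1) ↔ ∀ w ∈ ws, A.eval w = 1) ∧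
          (gather (sections A N B ws) = [] → c.1 = .accept) ∧
          (gather (sections A N B ws) ≠ [] → c = reading false id (fun _ => [])
            ((gather (sections A N B ws)).flatMap (enc B true))))) := by
  rcases reaches_words (A := A) hB ws (fun _ => []) (by simp [Closed])
    with ⟨h, h1⟩ | ⟨h, c, hc, h1⟩
  · simp only [List.append_nil] at h1
    have h2 := StackMachine.Reaches.single (step_reading_nil (A := A) (N := N) (b := false) id
      (fun x => ((sections A N B ws x).flatMap (enc B true)).reverse) (by simp))
    have hcl : ∀ x, Closed (((sections A N B ws x).flatMap (enc B true)).reverse) := by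
      intro x
      induction sections A N B ws x using List.reverseRecOn with
      | nil => simp [Closed]
      | append_singleton l w ih =>
        rw [List.flatMap_append, List.reverse_append]
        simpa using closed_enc w _
    -- After the first pass every top cell is marked already, so the closing mark changes nothing.
    have hR : ∀ R : List (Cell S B), Closed R →
        (R.head?.map fun g => (g.1, true)).toList ++ R.tail = R := by
      rintro (_ | ⟨⟨c, e⟩, R⟩) hR
      · rfl
      · have : e = true := hR _ rfl
        subst this; rfl
    simp only [hR _ (hcl _)] at h2
    obtain ⟨c, h3, h4, h5⟩ := reaches_next (A := A) (N := N) (sections A N B ws)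
      (fun x => ((sections A N B ws x).flatMap (enc B true)).reverse) (fun _ => rfl)
    refine ⟨c, ((h1.trans h2).trans h3).mono (by omega), .inr ⟨?_, h4, h5⟩⟩
    constructor
    · intro h6 w hw
      by_cases hwB : w.length ≤ B
      · exact (h w hw).1 hwB
      · push Not at hwB
        refine (A.eval_eq_one_iff w).2 ⟨(h w hw).2 hwB, fun x => ?_⟩
        rw [← A.eval_redSec N]
        apply h6
        simp only [gather, sections, List.mem_flatMap, List.mem_reverse, Finset.mem_toList,
          Finset.mem_univ, true_and, List.mem_map, List.mem_filter, decide_eq_true_eq]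
        exact ⟨x, w, ⟨hw, hwB⟩, rfl⟩
    · intro h6 w hw
      simp only [gather, sections, List.mem_flatMap, List.mem_reverse, Finset.mem_toList,
        Finset.mem_univ, true_and, List.mem_map, List.mem_filter, decide_eq_true_eq] at hw
      obtain ⟨x, w, ⟨hw, -⟩, rfl⟩ := hw
      rw [A.eval_redSec]
      exact ((A.eval_eq_one_iff w).1 (h6 w hw)).2 x
  · exact ⟨c, h1.mono (by omega), .inl ⟨hc, h⟩⟩

end WordProblemMachine

/-! ### Running time of the recursion, and the first pass. -/

namespace WordProblemMachine

variable {S : Type u} {X : Type v} [Fintype X] {A : InvertibleAutomaton S X} {N B : ℕ} [NeZero B]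

open Cell

theorem sum_gather {S : Type u} (out : X → List (List S)) (f : List S → ℝ) :
    ((gather out).map f).sum = ∑ x, ((out x).map f).sum := by
  rw [gather, List.map_flatMap, List.flatMap_def, List.sum_flatten, List.map_map,
    List.map_reverse, List.sum_reverse, Finset.sum_map_toList]
  rfl

open Classical in
theorem sum_sections {S : Type u} {A : InvertibleAutomaton S X} {N B : ℕ} (ws : List (List S))
    (f : List S → ℝ) :
    ((gather (sections A N B ws)).map f).sum =
      ((ws.filter fun w => B < w.length).map fun w => ∑ x, f (A.redSec N w x)).sum := by
  rw [sum_gather]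
  simp only [sections]
  induction ws.filter fun w => B < w.length with
  | nil => simp
  | cons w l ih =>
    simp only [List.map_cons, List.sum_cons]
    rw [← ih, Finset.sum_add_distrib]

theorem sum_filter_le {α : Type*} (p : α → Bool) (f : α → ℝ) (hf : ∀ a, 0 ≤ f a) (l : List α) :
    ((l.filter p).map f).sum ≤ (l.map f).sum := by
  induction l with
  | nil => simp
  | cons a l ih =>
    by_cases h : p a
    · simpa [h] using ih
    · simpa [h] using ih.trans (le_add_of_nonneg_left (hf a))

theorem length_flatMap_enc_le {S : Type u} (ws : List (List S)) :
    (((ws.flatMap (enc B true)).length : ℕ) : ℝ) ≤ (ws.map fun w => (w.length : ℝ) + 1).sum := by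
  induction ws with
  | nil => simp
  | cons w ws ih =>
    simp only [List.flatMap_cons, List.length_append, Nat.cast_add, List.map_cons, List.sum_cons]
    have : (((enc B true w).length : ℕ) : ℝ) ≤ w.length + 1 := by
      exact_mod_cast length_enc_le true w
    linarith

/-- If a quantity `F` of words that do not fit into a cell grows at most by the factor `μ` from one
level to the next, and another quantity `Φ` of single words shrinks by the factor `ρ`, then the
running time is bounded by a geometric sum. -/
theorem reaches_halt (hB : N + 1 ∣ B) {Φ F : List S → ℝ} {ρ μ K : ℝ} (hρ : 0 ≤ ρ) (hμ : 0 ≤ μ)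
    (hK : 0 ≤ K) (hΦ : ∀ w, (w.length : ℝ) ≤ Φ w)
    (hΦρ : ∀ w x, B < w.length → Φ (A.redSec N w x) ≤ ρ * Φ w) (hF0 : ∀ w, 0 ≤ F w)
    (hF : ∀ w, B < w.length → (w.length : ℝ) ≤ K * F w)
    (hFμ : ∀ w, B < w.length → ∑ x, F (A.redSec N w x) ≤ μ * F w) (D : ℕ) (ws : List (List S))
    (hD : ∀ w ∈ ws, Φ w * ρ ^ D < 1) :
    ∃ c n, (machine A N B).Reaches n
        (reading false id (fun _ => []) (ws.flatMap (enc B true))) c ∧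
      (n : ℝ) ≤ (ws.flatMap (enc B true)).length + (Fintype.card X + 2) +
        (5 * Fintype.card X + 2) * K * (∑ i ∈ Finset.range D, μ ^ i) * (ws.map F).sum ∧
      ((c.1 = .accept ∧ ∀ w ∈ ws, A.eval w = 1) ∨ (c.1 = .reject ∧ ∃ w ∈ ws, A.eval w ≠ 1)) := by
  classical
  have hBpos := NeZero.pos B
  induction D generalizing ws with
  | zero =>
    have hshort : gather (sections A N B ws) = [] := by
      have : ws.filter (fun w => B < w.length) = [] := by
        rw [List.filter_eq_nil_iff]
        intro w hw h
        -- At depth 0 the potential is below 1, and it dominates the length, so no word is longer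
        -- than a cell.
        have h1 := hD w hw
        have h2 := hΦ w
        have h3 : B < w.length := by simpa using h
        have h4 : (1 : ℝ) ≤ w.length := by exact_mod_cast (by omega : 1 ≤ w.length)
        rw [pow_zero, mul_one] at h1
        linarith
      simp [gather, sections, this]
    obtain ⟨c, h1, h2⟩ := reaches_level (A := A) hB ws
    rw [hshort] at h1
    refine ⟨c, _, h1, by simp [add_assoc], ?_⟩
    rcases h2 with h2 | ⟨h2, h3, -⟩
    · exact .inr h2
    · exact .inl ⟨h3 hshort, h2.1 (by simp [hshort])⟩
  | succ D ih =>
    obtain ⟨c, h1, h2⟩ := reaches_level (A := A) hB ws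
    have hFs : 0 ≤ (ws.map F).sum := List.sum_nonneg (by simpa using fun w _ => hF0 w)
    have hgeo : 0 ≤ ∑ i ∈ Finset.range D, μ ^ i := Finset.sum_nonneg fun i _ => pow_nonneg hμ i
    have hgeo' : ∑ i ∈ Finset.range (D + 1), μ ^ i =
        μ * (∑ i ∈ Finset.range D, μ ^ i) + 1 := by
      rw [Finset.sum_range_succ', Finset.mul_sum, pow_zero]
      simp only [pow_succ']
    have hcard : (0 : ℝ) ≤ Fintype.card X := Nat.cast_nonneg _
    have hextra : 0 ≤ (5 * (Fintype.card X : ℝ) + 2) * K *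
        (∑ i ∈ Finset.range (D + 1), μ ^ i) * (ws.map F).sum := by
      rw [hgeo']; positivity
    by_cases hnil : gather (sections A N B ws) = []
    · rw [hnil] at h1
      refine ⟨c, _, h1, ?_, ?_⟩
      · simp only [List.flatMap_nil, List.length_nil, add_zero]
        push_cast
        linarith
      · rcases h2 with h2 | ⟨h2, h3, -⟩
        · exact .inr h2
        · exact .inl ⟨h3 hnil, h2.1 (by simp [hnil])⟩
    · have hlive : ∃ w ∈ ws, B < w.length := by
        by_contra! hcon
        apply hnil
        have : ws.filter (fun w => B < w.length) = [] := by
          rw [List.filter_eq_nil_iff]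
          intro w hw h
          have := hcon w hw
          simp at h
          omega
        simp [gather, sections, this]
      have hle : ((ws.filter fun w => B < w.length).map F).sum ≤ (ws.map F).sum :=
        sum_filter_le _ _ hF0 _
      -- A word that does not fit into a cell contributes at least 1. This allows the constant cost
      -- of a level to be charged to `F`.
      have hone : 1 ≤ K * (ws.map F).sum := by
        obtain ⟨w, hw, hwB⟩ := hlive
        have h3 : (1 : ℝ) ≤ w.length := by exact_mod_cast (by omega : 1 ≤ w.length)
        have h4 : F w ≤ (ws.map F).sum :=
          List.single_le_sum (by simpa using fun w _ => hF0 w) _ (List.mem_map_of_mem hw)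
        exact (h3.trans (hF w hwB)).trans (mul_le_mul_of_nonneg_left h4 hK)
      -- A section fills at most its length plus 1 cells. The nonempty parent `w` pays for both
      -- terms, hence at most `2 * K * F w` for each letter.
      have hcells : (((gather (sections A N B ws)).flatMap (enc B true)).length : ℝ) ≤
          2 * Fintype.card X * K * (ws.map F).sum := by
        refine (length_flatMap_enc_le _).trans ?_
        rw [sum_sections]
        have h3 : ((ws.filter fun w => B < w.length).map fun w =>
            ∑ x, (((A.redSec N w x).length : ℝ) + 1)).sum ≤
            ((ws.filter fun w => B < w.length).map fun w =>
              2 * (Fintype.card X : ℝ) * K * F w).sum := by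
          apply List.sum_le_sum
          intro w hw
          have hw' : B < w.length := by simpa using (List.mem_filter.1 hw).2
          have h4 : (1 : ℝ) ≤ w.length := by exact_mod_cast (by omega : 1 ≤ w.length)
          calc ∑ x, (((A.redSec N w x).length : ℝ) + 1)
              ≤ ∑ _x : X, 2 * (K * F w) := by
                apply Finset.sum_le_sum
                intro x _
                have h5 : ((A.redSec N w x).length : ℝ) ≤ w.length := by
                  exact_mod_cast A.length_redSec_le N w x
                linarith [hF w hw']
            _ = 2 * (Fintype.card X : ℝ) * K * F w := by
                rw [Finset.sum_const, nsmul_eq_mul, Finset.card_univ]; ring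
        rw [List.sum_map_mul_left] at h3
        exact h3.trans (mul_le_mul_of_nonneg_left hle (by positivity))
      rcases h2 with h2 | ⟨h2, -, h3⟩
      · refine ⟨c, _, h1, ?_, .inr h2⟩
        push_cast
        have h4 : 2 * (Fintype.card X : ℝ) * K * (ws.map F).sum ≤
          (5 * (Fintype.card X : ℝ) + 2) * K * (∑ i ∈ Finset.range (D + 1), μ ^ i) *
            (ws.map F).sum := by
          apply mul_le_mul_of_nonneg_right _ hFs
          rw [hgeo']
          have h5 : 0 ≤ μ * ∑ i ∈ Finset.range D, μ ^ i := mul_nonneg hμ hgeo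
          nlinarith [mul_nonneg hcard hK, mul_nonneg (mul_nonneg hcard hK) h5, mul_nonneg hK h5]
        linarith
      · obtain rfl := h3 hnil
        obtain ⟨c, n, h4, h5, h6⟩ := ih (gather (sections A N B ws)) (by
          intro w hw
          simp only [gather, sections, List.mem_flatMap, List.mem_reverse, Finset.mem_toList,
            Finset.mem_univ, true_and, List.mem_map, List.mem_filter, decide_eq_true_eq] at hw
          obtain ⟨x, w, ⟨hw, hwB⟩, rfl⟩ := hw
          calc _ ≤ (ρ * Φ w) * ρ ^ D := mul_le_mul_of_nonneg_right (hΦρ w x hwB) (pow_nonneg hρ D)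
            _ = Φ w * ρ ^ (D + 1) := by ring
            _ < 1 := hD w hw)
        refine ⟨c, _, h1.trans h4, ?_, ?_⟩
        · have h7 : ((gather (sections A N B ws)).map F).sum ≤ μ * (ws.map F).sum := by
            rw [sum_sections]
            have h8 : ((ws.filter fun w => B < w.length).map fun w =>
                ∑ x, F (A.redSec N w x)).sum ≤
                ((ws.filter fun w => B < w.length).map fun w => μ * F w).sum := by
              apply List.sum_le_sum
              intro w hw
              exact hFμ w (by simpa using (List.mem_filter.1 hw).2)
            rw [List.sum_map_mul_left] at h8
            exact h8.trans (mul_le_mul_of_nonneg_left hle hμ)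
          have h9 : (5 * (Fintype.card X : ℝ) + 2) * K * (∑ i ∈ Finset.range D, μ ^ i) *
              ((gather (sections A N B ws)).map F).sum ≤
              (5 * (Fintype.card X : ℝ) + 2) * K * (∑ i ∈ Finset.range D, μ ^ i) *
                (μ * (ws.map F).sum) := mul_le_mul_of_nonneg_left h7 (by positivity)
          have h10 : ((Fintype.card X : ℝ) + 2) * 1 ≤
              ((Fintype.card X : ℝ) + 2) * (K * (ws.map F).sum) :=
            mul_le_mul_of_nonneg_left hone (by positivity)
          -- The cells of the next level are counted twice, as written here and as read in the next
          -- pass. Twice `2 * |X|` and the constant cost `|X| + 2` give the factor `5 * |X| + 2`.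
          rw [hgeo']
          push_cast
          linarith
        · rw [h2] at h6
          have h7 : (∃ w ∈ gather (sections A N B ws), A.eval w ≠ 1) ↔ ∃ w ∈ ws, A.eval w ≠ 1 := by
            have := not_congr h2
            push Not at this
            exact this
          rwa [h7] at h6

/-- Reading input letters. -/
theorem reaches_input (cs : List (Cell S B)) (hcs : ∀ c ∈ cs, c.2 = false) (σ : X → X)
    (out : X → List S) :
    ∃ z : X → List S, (∀ x, A.eval (z x) = A.eval (A.sec (cs.flatMap fun c => c.1.1) [σ x])) ∧
      (∀ x, (z x).length ≤ B * cs.length) ∧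
      (machine A N B).Reaches cs.length
        (reading true σ (fun x => (enc B false (out x)).reverse) cs)
        (reading true (fun x => A.act (cs.flatMap fun c => c.1.1) (σ x))
          (fun x => (enc B false (out x ++ z x)).reverse) []) := by
  induction cs generalizing σ out with
  | nil =>
    exact ⟨fun _ => [], fun x => rfl, by simp, by
      simpa using StackMachine.Reaches.refl _ _⟩
  | cons c cs ih =>
    have hc : c.2 = false := hcs c (by simp)
    have hs := fun x => length_redSec_le_of_le (A := A) (N := N) c.1.2 (σ x)
    obtain ⟨z, h1, h2, h3⟩ := ih (fun c hc => hcs c (by simp [hc])) (fun x => A.act c.1.1 (σ x))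
      (fun x => out x ++ A.redSec N c.1.1 (σ x))
    -- Input cells need not be full, so the cuts may differ from those of `redSec` on the whole
    -- word. Only the represented element and the length matter here.
    refine ⟨fun x => A.redSec N c.1.1 (σ x) ++ z x, fun x => ?_, fun x => ?_, ?_⟩
    · rw [A.eval_append, h1, A.eval_redSec, ← A.eval_append, ← A.sec_append_singleton,
        List.flatMap_cons]
    · have := hs x
      have := h2 x
      rw [List.length_append, List.length_cons, Nat.mul_succ]
      omega
    · have h4 : (machine A N B).step
          (reading true σ (fun x => (enc B false (out x)).reverse) (c :: cs)) =
          reading true (fun x => A.act c.1.1 (σ x))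
            (fun x => (enc B false (out x ++ A.redSec N c.1.1 (σ x))).reverse) cs := by
        rw [step_reading _ _ _ _ (by simp) (by simp [hc]), hc]
        have h5 := fun x => pushOn_enc (B := B) (out x) [] (hs x) false
        simp only [List.append_nil] at h5
        simp only [h5]
        rfl
      simp only [List.flatMap_cons, A.act_append, List.length_cons, ← List.append_assoc]
      rw [add_comm]
      exact (StackMachine.Reaches.single h4).trans h3

/-- The first pass. -/
theorem reaches_first (cs : List (Cell S B)) (hcs : ∀ c ∈ cs, c.2 = false) :
    ∃ (ws : List (List S)) (c : _), ws.length ≤ Fintype.card X ∧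
      (∀ w ∈ ws, w.length ≤ B * cs.length) ∧
      (machine A N B).Reaches
        (cs.length + (ws.flatMap (enc B true)).length + Fintype.card X + 2)
        (reading false id (fun _ => []) cs) c ∧
      ((c.1 = .reject ∧ A.eval (cs.flatMap fun c => c.1.1) ≠ 1) ∨
        (((∀ w ∈ ws, A.eval w = 1) ↔ A.eval (cs.flatMap fun c => c.1.1) = 1) ∧
          (ws = [] → c.1 = .accept) ∧
          (ws ≠ [] → c = reading false id (fun _ => []) (ws.flatMap (enc B true))))) := by
  rcases cs with _ | ⟨c, cs⟩
  · have h1 := StackMachine.Reaches.single (step_reading_nil (A := A) (N := N) (B := B)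
      (b := false) id (fun _ => []) (by simp))
    obtain ⟨c, h2, h3, h4⟩ := reaches_next (A := A) (N := N) (B := B) (fun _ => [])
      (fun _ => []) (by simp)
    have hg : gather (fun _ : X => ([] : List (List S))) = [] := by simp [gather]
    rw [hg] at h2 h3
    exact ⟨[], c, by simp, by simp, (h1.trans h2).mono (by simp; omega),
      .inr ⟨by simp, fun _ => h3 rfl, fun h => absurd rfl h⟩⟩
  · have hc : c.2 = false := hcs c (by simp)
    have hs := fun x => length_redSec_le_of_le (A := A) (N := N) c.1.2 x
    have h1 : (machine A N B).step (reading false id (fun _ => []) (c :: cs)) =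
        reading true (A.act c.1.1)
          (fun x => (enc B false (A.redSec N c.1.1 x)).reverse) cs := by
      rw [step_reading _ _ _ _ (by simp [hc]) (by simp [hc]), hc]
      have h5 := fun x => pushOn_closed (B := B) (R := []) (by simp [Closed]) (hs x) false
      simp only [List.append_nil] at h5
      simp only [id, h5]
      rfl
    obtain ⟨z, h2, h3, h4⟩ := reaches_input (A := A) (N := N) cs
      (fun c hc => hcs c (by simp [hc])) (A.act c.1.1) (fun x => A.redSec N c.1.1 x)
    have h5 := (StackMachine.Reaches.single h1).trans h4
    have hact : ∀ x, A.act (cs.flatMap fun c => c.1.1) (A.act c.1.1 x) =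
        A.act ((c :: cs).flatMap fun c => c.1.1) x := fun x => by
      rw [List.flatMap_cons, A.act_append]
    simp only [hact] at h5
    by_cases hid : ∀ x, A.act ((c :: cs).flatMap fun c => c.1.1) x = x
    · have h6 := StackMachine.Reaches.single (step_reading_nil (A := A) (N := N) (B := B)
        (b := true) (A.act ((c :: cs).flatMap fun c => c.1.1))
        (fun x => (enc B false (A.redSec N c.1.1 x ++ z x)).reverse) (fun _ => hid))
      -- The unmarked input leaves all its sections open; the closing mark turns them into complete
      -- words.
      have hmark : ∀ y : List S, ((enc B false y).reverse.head?.map fun g => (g.1, true)).toList ++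
          (enc B false y).reverse.tail = (enc B true y).reverse := fun y => by
        obtain ⟨d, t, h⟩ := exists_enc_reverse (B := B) y
        rw [h, h]; rfl
      simp only [hmark] at h6
      obtain ⟨c', h7, h8, h9⟩ := reaches_next (A := A) (N := N) (B := B)
        (fun x => [A.redSec N c.1.1 x ++ z x])
        (fun x => (enc B true (A.redSec N c.1.1 x ++ z x)).reverse) (by simp)
      refine ⟨_, c', ?_, ?_, ((h5.trans h6).trans h7).mono ?_, .inr ⟨?_, h8, h9⟩⟩
      · simp [gather, List.length_flatMap]
      · simp only [gather, List.mem_flatMap, List.mem_reverse, Finset.mem_toList,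
          Finset.mem_univ, true_and, List.mem_singleton]
        rintro w ⟨x, rfl⟩
        have := hs x
        have := h3 x
        rw [List.length_append, List.length_cons, Nat.mul_succ]
        omega
      · simp only [List.length_cons]; omega
      · have h10 : ∀ x, A.eval (A.redSec N c.1.1 x ++ z x) =
            A.eval (A.sec ((c :: cs).flatMap fun c => c.1.1) [x]) := fun x => by
          rw [A.eval_append, h2, A.eval_redSec, ← A.eval_append, ← A.sec_append_singleton,
            List.flatMap_cons]
        rw [A.eval_eq_one_iff ((c :: cs).flatMap fun c => c.1.1)]
        simp only [gather, List.mem_flatMap, List.mem_reverse, Finset.mem_toList,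
          Finset.mem_univ, true_and, List.mem_singleton, ← h10]
        constructor
        · intro h; exact ⟨hid, fun x => h _ ⟨x, rfl⟩⟩
        · rintro ⟨-, h⟩ w ⟨x, rfl⟩; exact h x
    · push Not at hid
      have h6 := step_reading_nil_reject (A := A) (N := N) (B := B) (b := true) _
        (fun x => (enc B false (A.redSec N c.1.1 x ++ z x)).reverse) rfl hid
      refine ⟨[], _, by simp, by simp,
        (h5.trans (StackMachine.Reaches.single rfl)).mono (by simp; omega), .inl ⟨h6, fun h => ?_⟩⟩
      obtain ⟨x, hx⟩ := hid
      exact hx (((A.eval_eq_one_iff _).1 h).1 x)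

end WordProblemMachine

/-! ### From the recursion to a Turing machine for arbitrary generators. -/

namespace WordProblemMachine

variable {S : Type u} {X : Type v} [Fintype X] {A : InvertibleAutomaton S X}

open Cell

/-- The common frame of the three cases: `Φ` with rate `ρ` controls the depth, `F` with rate `μ` the
total size of a level. The constant `C` precedes `D`, because the depth is chosen in terms of it. -/
theorem exists_decidesInTime_wordProblem [Finite S]
    (hinv : ∀ s : S, ∃ s' : S, A.gen s' = (A.gen s)⁻¹) (T : Finset A.group) {N B₀ : ℕ}
    {Φ F : List S → ℝ} {ρ μ K : ℝ} (hρ : 0 ≤ ρ) (hμ : 0 ≤ μ)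
    (hK : 0 ≤ K) (hΦ : ∀ w, (w.length : ℝ) ≤ Φ w) (hΦK : ∀ w, Φ w ≤ K * w.length)
    (hΦρ : ∀ w x, B₀ < w.length → Φ (A.redSec N w x) ≤ ρ * Φ w)
    (hF0 : ∀ w, 0 ≤ F w) (hFle : ∀ w, F w ≤ w.length)
    (hF : ∀ w, B₀ < w.length → (w.length : ℝ) ≤ K * F w)
    (hFμ : ∀ w, B₀ < w.length → ∑ x, F (A.redSec N w x) ≤ μ * F w) :
    ∃ C : ℝ, 0 ≤ C ∧ ∀ D : ℕ → ℕ, (∀ n : ℕ, C * n * ρ ^ D n < 1) → ∃ f : ℕ → ℕ,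
      (∀ n, (f n : ℝ) ≤ C * (n + 1) * (1 + ∑ i ∈ Finset.range (D n), μ ^ i)) ∧
      ∃ (k : ℕ) (M : MultiTapeTM T k), M.DecidesInTime (wordProblem T) f := by
  classical
  choose rep hrep using fun t : T => A.exists_eval_eq hinv t.1
  obtain ⟨B, hB, hBB, hBpos, hBrep⟩ : ∃ B, N + 1 ∣ B ∧ B₀ ≤ B ∧ B ≠ 0 ∧
      ∀ t, (rep t).length ≤ B := by
    obtain ⟨m, hm⟩ : ∃ m, ∀ t, (rep t).length ≤ m :=
      ⟨Finset.univ.sup fun t => (rep t).length, fun t =>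
        Finset.le_sup (f := fun t => (rep t).length) (Finset.mem_univ t)⟩
    -- A cell consists of whole blocks, exceeds the threshold `B₀`, and has room for a word
    -- representing any generator in `T`.
    have h : B₀ + m + 1 ≤ (N + 1) * (B₀ + m + 1) := Nat.le_mul_of_pos_left _ (by omega)
    exact ⟨(N + 1) * (B₀ + m + 1), dvd_mul_right _ _, by omega, by omega,
      fun t => (hm t).trans (by omega)⟩
  have : NeZero B := ⟨hBpos⟩
  let inp : T ↪ Cell S B := ⟨fun t => (⟨rep t, hBrep t⟩, false), fun t t' h => by
    have h1 : rep t = rep t' := congrArg (fun c : Cell S B => c.1.1) h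
    exact Subtype.ext (by rw [← hrep t, ← hrep t', h1])⟩
  set d : ℝ := (Fintype.card X : ℝ) with hd
  have hd0 : 0 ≤ d := Nat.cast_nonneg _
  set C₀ : ℝ := 1 + 2 * d * B + 4 * d + 4 + (5 * d + 2) * K * d * B with hC₀
  have hB0 : (0 : ℝ) ≤ B := Nat.cast_nonneg _
  have hC₀0 : 0 ≤ C₀ := by positivity
  -- Each stack step costs two moves, hence `2 * C₀`. After the first pass words have at most `B *
  -- n` letters, so `K * B * n` bounds their potential.
  refine ⟨2 * C₀ + K * B, by positivity, fun D hD => ?_⟩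
  have hgeo : ∀ n, 0 ≤ ∑ i ∈ Finset.range n, μ ^ i :=
    fun n => Finset.sum_nonneg fun i _ => pow_nonneg hμ i
  have hfl : ∀ n : ℕ, 0 ≤ C₀ * (n + 1) * (1 + ∑ i ∈ Finset.range (D n), μ ^ i) := fun n => by
    have := hgeo (D n); positivity
  refine ⟨fun n => 2 * ⌊C₀ * (n + 1) * (1 + ∑ i ∈ Finset.range (D n), μ ^ i)⌋₊, fun n => ?_, ?_⟩
  · have h1 := Nat.floor_le (hfl n)
    have h2 : 0 ≤ K * B * ((n : ℝ) + 1) * (1 + ∑ i ∈ Finset.range (D n), μ ^ i) := by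
      have := hgeo (D n); positivity
    push_cast
    linarith
  · apply (machine A N B).exists_decidesInTime (by simp [machine]) none inp
    intro w
    have heval : A.eval ((w.map inp).flatMap fun c => c.1.1) = (w.map Subtype.val).prod := by
      induction w with
      | nil => rfl
      | cons t w ih =>
        rw [List.map_cons, List.flatMap_cons, A.eval_append, ih, List.map_cons, List.prod_cons]
        congr 1
        exact hrep t
    have hstart : ((machine A N B).start, StackMachine.single none (w.map inp)) =
        reading false id (fun _ => []) (w.map inp) := by
      refine Prod.ext rfl ?_
      funext i
      cases i <;> simp [StackMachine.single, reading]
    have hmem : w ∈ wordProblem T ↔ A.eval ((w.map inp).flatMap fun c => c.1.1) = 1 := by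
      rw [heval]; rfl
    rw [hstart]
    suffices h : ∃ c n, (machine A N B).Reaches n (reading false id (fun _ => []) (w.map inp)) c ∧
        (n : ℝ) ≤ C₀ * (w.length + 1) * (1 + ∑ i ∈ Finset.range (D w.length), μ ^ i) ∧
        ((c.1 = .accept ∧ w ∈ wordProblem T) ∨ (c.1 = .reject ∧ w ∉ wordProblem T)) by
      obtain ⟨c, n, h1, h2, h3⟩ := h
      have h4 := (h1.mono (Nat.le_floor h2)).iterate_eq (by tauto)
      rw [h4]
      rcases h3 with ⟨h3, h5⟩ | ⟨h3, h5⟩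
      · exact ⟨fun _ => h3, fun h => absurd h5 h⟩
      · exact ⟨fun h => absurd h h5, fun _ => h3⟩
    obtain ⟨ws, c, h1, h2, h3, h4⟩ := reaches_first (A := A) (N := N) (w.map inp) (by
      intro c hc
      obtain ⟨t, -, rfl⟩ := List.mem_map.1 hc
      rfl)
    rw [List.length_map] at h2 h3
    have hgw := hgeo (D w.length)
    have hn : (0 : ℝ) ≤ w.length := Nat.cast_nonneg _
    have hlen : ∀ v ∈ ws, (v.length : ℝ) ≤ B * w.length := fun v hv => by exact_mod_cast h2 v hv
    have hsum : ∀ (f : List S → ℝ) (b : ℝ), 0 ≤ b → (∀ v ∈ ws, f v ≤ b) →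
        (ws.map f).sum ≤ d * b := fun f b hb hf => by
      have h5 : (ws.map f).sum ≤ (ws.map fun _ => b).sum := List.sum_le_sum hf
      rw [List.map_const', List.sum_replicate, nsmul_eq_mul] at h5
      exact h5.trans (mul_le_mul_of_nonneg_right (by rw [hd]; exact_mod_cast h1) hb)
    have hcells : (((ws.flatMap (enc B true)).length : ℕ) : ℝ) ≤ d * (B * w.length + 1) :=
      (length_flatMap_enc_le ws).trans
        (hsum _ _ (by positivity) fun v hv => by linarith [hlen v hv])
    have hp1 : 0 ≤ d * B * w.length := by positivity
    have hp2 : 0 ≤ (5 * d + 2) * K * d * B * w.length * (∑ i ∈ Finset.range (D w.length), μ ^ i) := by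
      positivity
    have hp3 : 0 ≤ (5 * d + 2) * K * d * B * w.length := by positivity
    have hbound : w.length + 2 * (d * (B * w.length + 1)) + 2 * d + 4 +
        (5 * d + 2) * K * (∑ i ∈ Finset.range (D w.length), μ ^ i) * (d * (B * w.length)) ≤
        C₀ * (w.length + 1) * (1 + ∑ i ∈ Finset.range (D w.length), μ ^ i) := by
      have e1 : C₀ * (w.length + 1) * 1 + ((5 * d + 2) * K * d * B) * w.length *
          (∑ i ∈ Finset.range (D w.length), μ ^ i) ≤
          C₀ * (w.length + 1) * (1 + ∑ i ∈ Finset.range (D w.length), μ ^ i) := by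
        rw [mul_add (C₀ * _)]
        refine add_le_add le_rfl (mul_le_mul_of_nonneg_right ?_ hgw)
        have h5 : (5 * d + 2) * K * d * B ≤ C₀ := by
          have : 0 ≤ 1 + 2 * d * B + 4 * d + 4 := by positivity
          rw [hC₀]; linarith
        exact mul_le_mul h5 (by linarith) hn hC₀0
      refine le_trans ?_ e1
      rw [hC₀]
      have : 0 ≤ d * B := by positivity
      have : 0 ≤ (5 * d + 2) * K * d * B := by positivity
      have : 0 ≤ d * w.length := by positivity
      linarith
    by_cases hws : ws = []
    · refine ⟨c, _, h3, ?_, ?_⟩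
      · push_cast
        have : 0 ≤ (5 * d + 2) * K * (∑ i ∈ Finset.range (D w.length), μ ^ i) *
            (d * (B * w.length)) := by positivity
        nlinarith
      · rw [hmem]
        rcases h4 with h4 | ⟨h4, h5, -⟩
        · exact .inr h4
        · exact .inl ⟨h5 hws, h4.1 (by simp [hws])⟩
    · rcases h4 with h4 | ⟨h4, -, h5⟩
      · refine ⟨c, _, h3, ?_, .inr (by rwa [hmem])⟩
        push_cast
        have : 0 ≤ (5 * d + 2) * K * (∑ i ∈ Finset.range (D w.length), μ ^ i) *
            (d * (B * w.length)) := by positivity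
        nlinarith
      · obtain rfl := h5 hws
        obtain ⟨c, n, h6, h7, h8⟩ := reaches_halt (A := A) hB hρ hμ hK hΦ
          (fun w x hw => hΦρ w x (by omega)) hF0 (fun w hw => hF w (by omega))
          (fun w hw => hFμ w (by omega)) (D w.length) ws (fun v hv => by
            refine lt_of_le_of_lt ?_ (hD w.length)
            apply mul_le_mul_of_nonneg_right _ (pow_nonneg hρ _)
            calc Φ v ≤ K * v.length := hΦK v
              _ ≤ K * (B * w.length) := mul_le_mul_of_nonneg_left (hlen v hv) hK
              _ ≤ (2 * C₀ + K * B) * w.length := by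
                have : 0 ≤ C₀ * w.length := by positivity
                linarith)
        refine ⟨c, _, h3.trans h6, ?_, ?_⟩
        · push_cast
          have h9 : (5 * d + 2) * K * (∑ i ∈ Finset.range (D w.length), μ ^ i) * (ws.map F).sum ≤
              (5 * d + 2) * K * (∑ i ∈ Finset.range (D w.length), μ ^ i) * (d * (B * w.length)) :=
            mul_le_mul_of_nonneg_left (hsum F _ (by positivity) fun v hv =>
              (hFle v).trans (hlen v hv)) (by positivity)
          linarith
        · rw [hmem, ← not_congr hmem, hmem, ← h4]
          rcases h8 with h8 | ⟨h8, h9⟩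
          · exact .inl h8
          · refine .inr ⟨h8, ?_⟩
            push Not
            exact h9

/-! ### Growth of the running time -/

/-- The depth is one more than the integer part of the logarithm of `C * n + 1` to the base `ρ⁻¹`;
the second bound expresses that it is logarithmic. -/
theorem exists_depth {ρ C : ℝ} (hρ : 0 < ρ) (hρ1 : ρ < 1) (hC : 0 ≤ C) :
    ∃ D : ℕ → ℕ, (∀ n : ℕ, C * n * ρ ^ D n < 1) ∧
      ∀ n : ℕ, ρ⁻¹ ^ D n ≤ ρ⁻¹ * (C * n + 1) := by
  have hinv : 1 < ρ⁻¹ := (one_lt_inv₀ hρ).2 hρ1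
  have h : ∀ n : ℕ, ∃ k : ℕ, ρ⁻¹ ^ k ≤ C * n + 1 ∧ C * n + 1 < ρ⁻¹ ^ (k + 1) := fun n =>
    exists_nat_pow_near (by have : 0 ≤ C * n := by positivity
                            linarith) hinv
  choose k h1 h2 using h
  refine ⟨fun n => k n + 1, fun n => ?_, fun n => ?_⟩
  · have h3 : C * n < (ρ ^ (k n + 1))⁻¹ := by rw [← inv_pow]; linarith [h2 n]
    rwa [← one_div, lt_div_iff₀ (by positivity)] at h3
  · rw [pow_succ, mul_comm]
    exact mul_le_mul_of_nonneg_left (h1 n) (inv_nonneg.2 hρ.le)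

open Asymptotics Filter

theorem isBigO_pow {ρ C μ : ℝ} (hρ : 0 < ρ) (hρ1 : ρ < 1) (hC : 0 ≤ C) (hμ : 0 ≤ μ)
    {D : ℕ → ℕ} (hD : ∀ n : ℕ, ρ⁻¹ ^ D n ≤ ρ⁻¹ * (C * n + 1)) {f : ℕ → ℕ}
    (hf : ∀ n, (f n : ℝ) ≤ C * (n + 1) * (1 + ∑ i ∈ Finset.range (D n), μ ^ i)) :
    ∃ e : ℕ, (fun n => (f n : ℝ)) =O[atTop] fun n => (n : ℝ) ^ e := by
  have hinv : 1 < ρ⁻¹ := (one_lt_inv₀ hρ).2 hρ1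
  -- The base `μ + 2` dominates the whole geometric sum, also for `μ ≤ 1`. As `ρ⁻¹ ^ D` is linear in
  -- `n`, the exponent `e` becomes the degree.
  obtain ⟨e, he⟩ := pow_unbounded_of_one_lt (μ + 2) hinv
  have hsum : ∀ D : ℕ, ∑ i ∈ Finset.range D, μ ^ i ≤ (μ + 2) ^ D := by
    intro D
    induction D with
    | zero => simp
    | succ D ih =>
      rw [Finset.sum_range_succ, pow_succ]
      have h1 : μ ^ D ≤ (μ + 2) ^ D := pow_le_pow_left₀ hμ (by linarith) D
      have h2 : 0 ≤ (μ + 2) ^ D * μ := by positivity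
      linarith
  refine ⟨e + 1, IsBigO.of_bound (2 * C * (1 + (ρ⁻¹ * (C + 1)) ^ e)) ?_⟩
  filter_upwards [eventually_ge_atTop 1] with n hn
  have hn' : (1 : ℝ) ≤ n := by exact_mod_cast hn
  rw [Real.norm_of_nonneg (Nat.cast_nonneg _), Real.norm_of_nonneg (by positivity)]
  have h1 : ∑ i ∈ Finset.range (D n), μ ^ i ≤ (ρ⁻¹ * (C + 1)) ^ e * n ^ e := by
    calc _ ≤ (μ + 2) ^ D n := hsum _
      _ ≤ (ρ⁻¹ ^ e) ^ D n := pow_le_pow_left₀ (by linarith) he.le _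
      _ = (ρ⁻¹ ^ D n) ^ e := by rw [← pow_mul, ← pow_mul, mul_comm]
      _ ≤ (ρ⁻¹ * (C + 1) * n) ^ e := by
        apply pow_le_pow_left₀ (by positivity)
        refine (hD n).trans ?_
        rw [mul_assoc]
        apply mul_le_mul_of_nonneg_left _ (by positivity)
        linarith
      _ = _ := mul_pow _ _ _
  have h2 : (1 : ℝ) ≤ n ^ e := one_le_pow₀ hn'
  calc (f n : ℝ) ≤ C * (n + 1) * (1 + ∑ i ∈ Finset.range (D n), μ ^ i) := hf n
    _ ≤ C * (2 * n) * (n ^ e + (ρ⁻¹ * (C + 1)) ^ e * n ^ e) := by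
      apply mul_le_mul _ (by linarith) _ (by positivity)
      · exact mul_le_mul_of_nonneg_left (by linarith) hC
      · have := Finset.sum_nonneg (s := Finset.range (D n)) fun i _ => pow_nonneg hμ i
        linarith
    _ = _ := by ring

theorem isBigO_mul_log {ρ C : ℝ} (hρ : 0 < ρ) (hρ1 : ρ < 1) (hC : 0 ≤ C)
    {D : ℕ → ℕ} (hD : ∀ n : ℕ, ρ⁻¹ ^ D n ≤ ρ⁻¹ * (C * n + 1)) {f : ℕ → ℕ}
    (hf : ∀ n, (f n : ℝ) ≤ C * (n + 1) * (1 + ∑ i ∈ Finset.range (D n), (1 : ℝ) ^ i)) :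
    (fun n => (f n : ℝ)) =O[atTop] fun n => (n : ℝ) * Real.log n := by
  have hinv : 1 < ρ⁻¹ := (one_lt_inv₀ hρ).2 hρ1
  have hl : 0 < Real.log ρ⁻¹ := Real.log_pos hinv
  have hl2 : 0 < Real.log 2 := Real.log_pos (by norm_num)
  have hlC : 0 ≤ Real.log (ρ⁻¹ * (C + 1)) := Real.log_nonneg (by nlinarith)
  refine IsBigO.of_bound (2 * C * ((1 + Real.log (ρ⁻¹ * (C + 1)) / Real.log ρ⁻¹) / Real.log 2 +
    1 / Real.log ρ⁻¹)) ?_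
  filter_upwards [eventually_ge_atTop 2] with n hn
  have hn' : (2 : ℝ) ≤ n := by exact_mod_cast hn
  have hln : Real.log 2 ≤ Real.log n := Real.log_le_log (by norm_num) hn'
  rw [Real.norm_of_nonneg (Nat.cast_nonneg _), Real.norm_of_nonneg (by positivity)]
  have h1 : (D n : ℝ) ≤ Real.log (ρ⁻¹ * (C + 1)) / Real.log ρ⁻¹ + Real.log n / Real.log ρ⁻¹ := by
    rw [← add_div, le_div_iff₀ hl, ← Real.log_pow, ← Real.log_mul (by positivity) (by positivity)]
    apply Real.log_le_log (by positivity)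
    refine (hD n).trans ?_
    rw [mul_assoc]
    apply mul_le_mul_of_nonneg_left _ (by positivity)
    linarith
  have h2 : 1 + Real.log (ρ⁻¹ * (C + 1)) / Real.log ρ⁻¹ ≤
      (1 + Real.log (ρ⁻¹ * (C + 1)) / Real.log ρ⁻¹) / Real.log 2 * Real.log n := by
    rw [div_mul_eq_mul_div, le_div_iff₀ hl2]
    exact mul_le_mul_of_nonneg_left hln (by positivity)
  calc (f n : ℝ) ≤ C * (n + 1) * (1 + ∑ i ∈ Finset.range (D n), (1 : ℝ) ^ i) := hf n
    _ = C * (n + 1) * (1 + D n) := by simp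
    _ ≤ C * (2 * n) * ((1 + Real.log (ρ⁻¹ * (C + 1)) / Real.log ρ⁻¹) / Real.log 2 * Real.log n +
          Real.log n / Real.log ρ⁻¹) := by
      apply mul_le_mul _ (by linarith) (by positivity) (by positivity)
      exact mul_le_mul_of_nonneg_left (by linarith) hC
    _ = _ := by ring

theorem isBigO_linear {C μ : ℝ} (hC : 0 ≤ C) (hμ : 0 ≤ μ) (hμ1 : μ < 1) {D f : ℕ → ℕ}
    (hf : ∀ n, (f n : ℝ) ≤ C * (n + 1) * (1 + ∑ i ∈ Finset.range (D n), μ ^ i)) :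
    (fun n => (f n : ℝ)) =O[atTop] fun n => (n : ℝ) := by
  refine IsBigO.of_bound (2 * C * (1 + (1 - μ)⁻¹)) ?_
  filter_upwards [eventually_ge_atTop 1] with n hn
  have hn' : (1 : ℝ) ≤ n := by exact_mod_cast hn
  rw [Real.norm_of_nonneg (Nat.cast_nonneg _), Real.norm_of_nonneg (by positivity)]
  have h1 : ∑ i ∈ Finset.range (D n), μ ^ i ≤ (1 - μ)⁻¹ := by
    rw [← tsum_geometric_of_lt_one hμ hμ1]
    exact (summable_geometric_of_lt_one hμ hμ1).sum_le_tsum _ fun i _ => pow_nonneg hμ i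
  have h2 := Finset.sum_nonneg (s := Finset.range (D n)) fun i _ => pow_nonneg hμ i
  calc (f n : ℝ) ≤ C * (n + 1) * (1 + ∑ i ∈ Finset.range (D n), μ ^ i) := hf n
    _ ≤ C * (2 * n) * (1 + (1 - μ)⁻¹) := by
      apply mul_le_mul _ (by linarith) (by positivity) (by positivity)
      exact mul_le_mul_of_nonneg_left (by linarith) hC
    _ = _ := by ring

end WordProblemMachine

namespace InvertibleAutomaton

variable {S : Type u} {X : Type v} {A : InvertibleAutomaton S X}

/-! ### Lengths of reduced sections -/

/-- Every complete block loses a letter, and the incomplete last one does not grow. -/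
theorem length_redSec_add_div_le {N : ℕ}
    (h : ∀ w : List S, w.length = N + 1 → ∀ x : X, A.len (A.sec w [x]) < N + 1)
    (w : List S) (x : X) : (A.redSec N w x).length + w.length / (N + 1) ≤ w.length := by
  induction w using blockInduction N generalizing x with
  | h w hw =>
    rw [Nat.div_eq_of_lt (by omega), add_zero]
    exact A.length_redSec_le N w x
  | h' b w hb ih =>
    rw [redSec_append _ hb, List.length_append, List.length_append, length_red, hb,
      Nat.add_div_left _ (by omega : 0 < N + 1)]
    have := h b hb x
    have := ih (A.act b x)
    omega

/-- A block permutes the letters, so the sum over all letters may be taken block by block. The error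
term comes from the incomplete last block; `δ` is the gain per block, 0 or 1 in the applications. -/
theorem sum_length_redSec_le [Fintype X] {N δ : ℕ}
    (h : ∀ w : List S, w.length = N + 1 → ∑ x : X, A.len (A.sec w [x]) + δ ≤ N + 1)
    (w : List S) :
    ∑ x, (A.redSec N w x).length + δ * (w.length / (N + 1)) ≤
      w.length + Fintype.card X * (N + 1) := by
  induction w using blockInduction N with
  | h w hw =>
    rw [Nat.div_eq_of_lt (by omega), mul_zero, add_zero]
    calc ∑ x, (A.redSec N w x).length ≤ ∑ _x : X, (N + 1) := Finset.sum_le_sum fun x _ =>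
          (A.length_redSec_le N w x).trans (by omega)
      _ ≤ _ := by simp
  | h' b w hb ih =>
    have h1 : ∑ x, (A.redSec N w (A.act b x)).length = ∑ x, (A.redSec N w x).length :=
      (A.act_bijective b).sum_comp fun x => (A.redSec N w x).length
    simp only [redSec_append _ hb, List.length_append, length_red, Finset.sum_add_distrib, h1]
    rw [hb, Nat.add_div_left _ (by omega : 0 < N + 1), Nat.mul_succ]
    have := h b hb
    omega

theorem sum_len_sec_le [Fintype X] {N : ℕ}
    (h : ∀ w : List S, w.length = N + 1 → ∑ x : X, A.len (A.sec w [x]) ≤ N + 1)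
    {w : List S} (hw : N + 1 ∣ w.length) : ∑ x : X, A.len (A.sec w [x]) ≤ w.length := by
  induction w using blockInduction N with
  | h w hw' =>
    have : w = [] := List.length_eq_zero_iff.1 (Nat.eq_zero_of_dvd_of_lt hw (by omega))
    subst this
    simp [(A.len_eq_zero_iff []).2 A.eval_nil]
  | h' b w hb ih =>
    have h1 : ∑ x, A.len (A.sec w [A.act b x]) = ∑ x, A.len (A.sec w [x]) :=
      (A.act_bijective b).sum_comp fun x => A.len (A.sec w [x])
    have h2 : N + 1 ∣ w.length := by simpa [hb] using hw
    calc ∑ x, A.len (A.sec (b ++ w) [x])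
        ≤ ∑ x, (A.len (A.sec b [x]) + A.len (A.sec w [A.act b x])) := by
          apply Finset.sum_le_sum
          intro x _
          rw [sec_append_singleton]
          exact A.len_append_le _ _
      _ ≤ _ := by
          rw [Finset.sum_add_distrib, h1, List.length_append]
          have := h b hb
          have := ih h2
          omega

end InvertibleAutomaton

/-! ### Truncated lengths; polynomial and linear time. -/

namespace WordProblemMachine

/-- If two terms exceed `c`, truncation saves `2 * c`, which pays for the error and for the loss on
the right. If only one does, it is bounded by `n` itself. -/
theorem sum_tsub_le {X : Type v} [Fintype X] {a : X → ℕ} {n c : ℕ} (ha : ∀ x, a x ≤ n)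
    (hs : ∑ x, a x ≤ n + c) : ∑ x, (a x - c) ≤ n - c := by
  classical
  by_cases h0 : ∃ x, c < a x
  · obtain ⟨x, hx⟩ := h0
    by_cases h1 : ∃ y, y ≠ x ∧ c < a y
    · obtain ⟨y, hyx, hy⟩ := h1
      have h2 : ∑ z, ((a z - c) + (if z = x then c else 0) + (if z = y then c else 0)) ≤
          ∑ z, a z := by
        apply Finset.sum_le_sum
        intro z _
        by_cases hzx : z = x
        · have hzy : z ≠ y := fun h => hyx (h ▸ hzx)
          simp only [hzx, if_true, if_neg (hzx ▸ hzy)]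
          omega
        · by_cases hzy : z = y
          · simp only [if_neg hzx, if_pos hzy]
            subst hzy; omega
          · simp only [if_neg hzx, if_neg hzy]
            omega
      simp only [Finset.sum_add_distrib, Finset.sum_ite_eq', Finset.mem_univ, if_true] at h2
      omega
    · push Not at h1
      rw [Finset.sum_eq_single x (fun y _ hy => Nat.sub_eq_zero_of_le (h1 y hy)) (by simp)]
      exact Nat.sub_le_sub_right (ha x) c
  · push Not at h0
    rw [Finset.sum_eq_zero fun x _ => Nat.sub_eq_zero_of_le (h0 x)]
    exact Nat.zero_le _

/-- Here a single term above `c` suffices: it saves `(l + 1) * c`, which is the error `c` plus the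
loss `l * c` on the right. -/
theorem sum_tsub_contract {X : Type v} [Fintype X] {a : X → ℕ} {n c l : ℕ} (hc : c < n)
    (hs : (l + 1) * ∑ x, a x ≤ l * n + c) : (l + 1) * ∑ x, (a x - c) ≤ l * (n - c) := by
  classical
  by_cases h0 : ∃ x, c < a x
  · obtain ⟨x, hx⟩ := h0
    have h2 : ∑ z, ((a z - c) + (if z = x then c else 0)) ≤ ∑ z, a z := by
      apply Finset.sum_le_sum
      intro z _
      by_cases hzx : z = x
      · subst hzx; simp only [if_true]; omega
      · simp only [if_neg hzx]; omega
    simp only [Finset.sum_add_distrib, Finset.sum_ite_eq', Finset.mem_univ, if_true] at h2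
    have h3 := Nat.mul_le_mul_left (l + 1) h2
    obtain ⟨m, rfl⟩ := Nat.exists_eq_add_of_lt hc
    have h4 : c + m + 1 - c = m + 1 := by omega
    rw [h4]
    nlinarith
  · push Not at h0
    rw [Finset.sum_eq_zero fun x _ => Nat.sub_eq_zero_of_le (h0 x)]
    simp

theorem le_mul_tsub {n c : ℕ} (h : c < n) : (n : ℝ) ≤ (c + 1) * ((n - c : ℕ) : ℝ) := by
  obtain ⟨m, rfl⟩ := Nat.exists_eq_add_of_lt h
  have h4 : c + m + 1 - c = m + 1 := by omega
  rw [h4]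
  push_cast
  nlinarith [(Nat.cast_nonneg c : (0 : ℝ) ≤ c), (Nat.cast_nonneg m : (0 : ℝ) ≤ m)]

variable {S : Type u} {X : Type v} [Fintype X] {A : InvertibleAutomaton S X}

theorem length_redSec_le_mul {S : Type u} {X : Type v} {A : InvertibleAutomaton S X} {N : ℕ}
    (h : ∀ w : List S, w.length = N + 1 → ∀ x : X, A.len (A.sec w [x]) < N + 1)
    (w : List S) (x : X) (hw : N + 1 < w.length) :
    ((A.redSec N w x).length : ℝ) ≤ (1 - 1 / (2 * (N + 1))) * w.length := by
  have h1 := A.length_redSec_add_div_le h w x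
  have h2 := Nat.div_add_mod w.length (N + 1)
  have h3 := Nat.mod_lt w.length (by omega : 0 < N + 1)
  have h4 : 1 ≤ w.length / (N + 1) := (Nat.one_le_div_iff (by omega : 0 < N + 1)).2 hw.le
  set q := w.length / (N + 1) with hq
  have h5 : w.length ≤ 2 * (N + 1) * q := by nlinarith
  have h6 : (w.length : ℝ) ≤ 2 * (N + 1) * q := by exact_mod_cast h5
  have h7 : ((A.redSec N w x).length : ℝ) + q ≤ w.length := by exact_mod_cast h1
  have h8 : (1 : ℝ) / (2 * (N + 1)) * w.length ≤ q := by
    rw [one_div, inv_mul_le_iff₀ (by positivity)]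
    exact h6
  linarith

theorem rate_pos (N : ℕ) : (0 : ℝ) < 1 - 1 / (2 * (N + 1)) := by
  have : (1 : ℝ) / (2 * (N + 1)) < 1 := by
    rw [div_lt_one (by positivity)]
    have := (Nat.cast_nonneg N : (0 : ℝ) ≤ N)
    linarith
  linarith

theorem rate_lt_one (N : ℕ) : (1 : ℝ) - 1 / (2 * (N + 1)) < 1 := by
  have : (0 : ℝ) < 1 / (2 * (N + 1)) := by positivity
  linarith

theorem mem_polyTime [Finite S] (hinv : ∀ s : S, ∃ s' : S, A.gen s' = (A.gen s)⁻¹)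
    (T : Finset A.group) {N : ℕ}
    (h : ∀ w : List S, w.length = N + 1 → ∀ x : X, A.len (A.sec w [x]) < N + 1) :
    wordProblem T ∈ PolyTime T := by
  obtain ⟨C, hC, H⟩ := exists_decidesInTime_wordProblem (A := A) hinv T (N := N) (B₀ := N + 1)
    (Φ := fun w => w.length) (F := fun w => w.length) (μ := Fintype.card X) (K := 1)
    (rate_pos N).le (Nat.cast_nonneg _) zero_le_one (fun _ => le_rfl) (by simp)
    (fun w x hw => length_redSec_le_mul h w x hw) (fun _ => Nat.cast_nonneg _) (fun _ => le_rfl)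
    (by simp) (fun w _ => by
      calc ∑ x, ((A.redSec N w x).length : ℝ) ≤ ∑ _x : X, (w.length : ℝ) :=
            Finset.sum_le_sum fun x _ => by exact_mod_cast A.length_redSec_le N w x
        _ = _ := by simp)
  obtain ⟨D, hD, hD'⟩ := exists_depth (rate_pos N) (rate_lt_one N) hC
  obtain ⟨f, hf, k, M, hM⟩ := H D hD
  obtain ⟨e, he⟩ := isBigO_pow (rate_pos N) (rate_lt_one N) hC (Nat.cast_nonneg _) hD' hf
  exact ⟨e, k, M, f, he, hM⟩

theorem mem_linearTime [Finite S] (hinv : ∀ s : S, ∃ s' : S, A.gen s' = (A.gen s)⁻¹)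
    (T : Finset A.group) {N : ℕ}
    (h : ∀ w : List S, w.length = N + 1 → ∑ x : X, A.len (A.sec w [x]) < N + 1) :
    wordProblem T ∈ DTIMEMulti (fun n => (n : ℝ)) T := by
  have h' : ∀ w : List S, w.length = N + 1 → ∀ x : X, A.len (A.sec w [x]) < N + 1 :=
    fun w hw x => lt_of_le_of_lt (Finset.single_le_sum (f := fun x => A.len (A.sec w [x]))
      (fun _ _ => Nat.zero_le _) (Finset.mem_univ x)) (h w hw)
  -- The error of `sum_length_redSec_le` multiplied by `N + 1`, plus a bound for the remainder of
  -- the division into blocks.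
  set c := (N + 1) * (Fintype.card X * (N + 1) + 1) with hc
  have hcN : N + 1 ≤ c := Nat.le_mul_of_pos_right _ (Nat.succ_pos _)
  have hN : (0 : ℝ) < N + 1 := by positivity
  have hμ1 : (N : ℝ) / (N + 1) < 1 := by rw [div_lt_one hN]; linarith
  obtain ⟨C, hC, H⟩ := exists_decidesInTime_wordProblem (A := A) hinv T (N := N) (B₀ := c)
    (Φ := fun w => w.length) (F := fun w => ((w.length - c : ℕ) : ℝ)) (μ := (N : ℝ) / (N + 1))
    (K := c + 1) (rate_pos N).le (by positivity) (by positivity) (fun _ => le_rfl)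
    (fun w => le_mul_of_one_le_left (Nat.cast_nonneg _)
      (le_add_of_nonneg_left (Nat.cast_nonneg _)))
    (fun w x hw => length_redSec_le_mul h' w x (lt_of_le_of_lt hcN hw))
    (fun _ => Nat.cast_nonneg _) (fun w => by exact_mod_cast Nat.sub_le _ _)
    (fun w hw => le_mul_tsub hw) (fun w hw => by
      have h1 := A.sum_length_redSec_le (δ := 1) (fun w hw => h w hw) w
      have h2 := Nat.div_add_mod w.length (N + 1)
      have h3 := Nat.mod_lt w.length (by omega : 0 < N + 1)
      have h4 : (N + 1) * ∑ x, (A.redSec N w x).length ≤ N * w.length + c := by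
        rw [hc]
        nlinarith
      have h5 := sum_tsub_contract hw h4
      rw [div_mul_eq_mul_div, le_div_iff₀ hN, mul_comm]
      exact_mod_cast h5)
  obtain ⟨D, hD, hD'⟩ := exists_depth (rate_pos N) (rate_lt_one N) hC
  obtain ⟨f, hf, k, M, hM⟩ := H D hD
  exact ⟨k, M, f, isBigO_linear hC (by positivity) hμ1 hf, hM⟩

end WordProblemMachine

namespace InvertibleAutomaton

variable {S : Type u} {X : Type v} {A : InvertibleAutomaton S X}

/-! ### Words that keep their length along a path -/

theorem actWord_word_append (w : List S) (v v' : List X) :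
    A.actWord w (v ++ v') = A.actWord w v ++ A.actWord (A.sec w v) v' := by
  induction v generalizing w with
  | nil => simp
  | cons x v ih => simp [actWord_cons, ih, A.sec_word_cons w x v]

theorem actWord_take (w : List S) (v : List X) (i : ℕ) :
    A.actWord w (v.take i) = (A.actWord w v).take i := by
  by_cases hi : i ≤ v.length
  · have h1 : A.actWord w v =
        A.actWord w (v.take i) ++ A.actWord (A.sec w (v.take i)) (v.drop i) := by
      rw [← actWord_word_append, List.take_append_drop]
    have h2 : (A.actWord w (v.take i)).length = i := by
      rw [length_actWord, List.length_take]; omega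
    rw [h1, List.take_append_of_le_length h2.ge, List.take_of_length_le h2.le]
  · rw [List.take_of_length_le (by omega), List.take_of_length_le (by simp; omega)]

/-- Length is subadditive, so a product of full length has factors of full length. -/
theorem len_sec_left_eq {w w' : List S} {v : List X}
    (h : A.len (A.sec (w ++ w') v) = (w ++ w').length) : A.len (A.sec w v) = w.length := by
  rw [sec_append] at h
  have h1 := A.len_append_le (A.sec w v) (A.sec w' (A.actWord w v))
  have h2 := A.len_le_length (A.sec w v)
  have h3 := A.len_le_length (A.sec w' (A.actWord w v))
  simp only [length_sec, List.length_append] at *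
  omega

theorem len_sec_right_eq {w w' : List S} {v : List X}
    (h : A.len (A.sec (w ++ w') v) = (w ++ w').length) :
    A.len (A.sec w' (A.actWord w v)) = w'.length := by
  rw [sec_append] at h
  have h1 := A.len_append_le (A.sec w v) (A.sec w' (A.actWord w v))
  have h2 := A.len_le_length (A.sec w v)
  have h3 := A.len_le_length (A.sec w' (A.actWord w v))
  simp only [length_sec, List.length_append] at *
  omega

theorem len_sec_singleton_eq {w : List S} {x : X} {v : List X}
    (h : A.len (A.sec w (x :: v)) = w.length) : A.len (A.sec w [x]) = w.length := by
  have h1 := A.len_sec_le (A.sec w [x]) v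
  rw [← sec_word_cons] at h1
  have h2 := A.len_le_length (A.sec w [x])
  rw [length_sec] at h2
  omega

/-- One section of full length exhausts the sum, so nothing is left for the others. -/
theorem eval_sec_eq_one_of_ne [Fintype X] {w : List S}
    (hw : ∑ x : X, A.len (A.sec w [x]) ≤ w.length) {x y : X}
    (hx : A.len (A.sec w [x]) = w.length) (hyx : y ≠ x) : A.eval (A.sec w [y]) = 1 := by
  classical
  rw [← len_eq_zero_iff]
  have h1 : ∑ z ∈ {x, y}, A.len (A.sec w [z]) ≤ ∑ z, A.len (A.sec w [z]) :=
    Finset.sum_le_sum_of_subset (Finset.subset_univ _)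
  rw [Finset.sum_pair hyx.symm] at h1
  omega

/-- A block can keep its length along at most one path. -/
theorem path_unique [Fintype X] {N : ℕ}
    (h : ∀ w : List S, w.length = N + 1 → ∑ x : X, A.len (A.sec w [x]) ≤ N + 1)
    {b : List S} (hb : b.length = N + 1) {v v' : List X}
    (hv : v.length = v'.length) (h1 : A.len (A.sec b v) = N + 1)
    (h2 : A.len (A.sec b v') = N + 1) : v = v' := by
  induction v generalizing b v' with
  | nil => exact (List.length_eq_zero_iff.1 hv.symm).symm
  | cons x v ih =>
    obtain _ | ⟨y, v'⟩ := v'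
    · simp at hv
    · have h3 := len_sec_singleton_eq (h1.trans hb.symm)
      by_cases hyx : y = x
      · subst hyx
        rw [sec_word_cons] at h1 h2
        rw [ih (by rw [length_sec, hb]) (by simpa using hv) h1 h2]
      · have h4 := eval_sec_eq_one_of_ne ((h b hb).trans hb.ge) h3 hyx
        rw [sec_word_cons] at h2
        have h5 := A.len_sec_le (A.sec b [y]) v'
        rw [(A.len_eq_zero_iff _).2 h4, h2] at h5
        omega

/-- Two words that keep their length along the same path act in the same way if they act in the
same way on the letters at the vertices of the path. -/
theorem actWord_eq_of_path [Fintype X] {N : ℕ}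
    (h : ∀ w : List S, w.length = N + 1 → ∑ x : X, A.len (A.sec w [x]) ≤ N + 1)
    {w w' : List S} {v : List X}
    (hw : N + 1 ∣ w.length) (hw' : N + 1 ∣ w'.length) (hv : A.len (A.sec w v) = w.length)
    (hv' : A.len (A.sec w' v) = w'.length)
    (hact : ∀ i, A.act (A.sec w (v.take i)) = A.act (A.sec w' (v.take i))) (y : List X)
    (hy : y.length ≤ v.length) : A.actWord w y = A.actWord w' y := by
  induction v generalizing w w' y with
  | nil => rw [List.length_eq_zero_iff.1 (Nat.le_zero.1 hy)]; simp
  | cons x v ih =>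
    obtain _ | ⟨z, y⟩ := y
    · simp
    · have h0 := hact 0
      rw [List.take_zero, sec_word_nil, sec_word_nil] at h0
      rw [actWord_cons, actWord_cons, h0]
      congr 1
      by_cases hz : z = x
      · subst hz
        refine ih (by simpa) (by simpa) ?_ ?_ (fun i => ?_) y (by simpa using hy)
        · rwa [← sec_word_cons, length_sec]
        · rwa [← sec_word_cons, length_sec]
        · have := hact (i + 1)
          rwa [List.take_succ_cons, sec_word_cons, A.sec_word_cons w'] at this
      -- Off the path both sections are trivial, so the actions along the path decide.
      · have h1 := eval_sec_eq_one_of_ne (sum_len_sec_le h hw) (len_sec_singleton_eq hv) hz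
        have h2 := eval_sec_eq_one_of_ne (sum_len_sec_le h hw') (len_sec_singleton_eq hv') hz
        exact A.eval_eq_iff.1 (h1.trans h2.symm) y

/-- Finitely many words are told apart by the letters at some level. -/
theorem exists_separating_level [Finite S] (n : ℕ) : ∃ k : ℕ, ∀ w w' : List S, w.length ≤ n →
    w'.length ≤ n → (∀ y : List X, y.length ≤ k → A.actWord w y = A.actWord w' y) →
    A.eval w = A.eval w' := by
  classical
  have hfin := List.finite_length_le S n
  have : ∀ p : List S × List S, ∃ k : ℕ,
      (∀ y : List X, y.length ≤ k → A.actWord p.1 y = A.actWord p.2 y) →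
      A.eval p.1 = A.eval p.2 := by
    intro p
    by_cases hp : A.eval p.1 = A.eval p.2
    · exact ⟨0, fun _ => hp⟩
    · rw [eval_eq_iff] at hp
      push Not at hp
      obtain ⟨y, hy⟩ := hp
      exact ⟨y.length, fun h => absurd (h y le_rfl) hy⟩
  choose k hk using this
  obtain ⟨m, hm⟩ := ((hfin.prod hfin).image k).bddAbove
  refine ⟨m, fun w w' hw hw' h => hk (w, w') fun y hy => h y (hy.trans ?_)⟩
  exact hm ⟨(w, w'), ⟨hw, hw'⟩, rfl⟩

/-- The action of the first `j` blocks of `u` on letters, given the action of the blocks. -/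
def composeBlocks (u : List S) (n : ℕ) (σ : {b : List S // b.length ≤ n} → X → X) : ℕ → X → X
  | 0, x => x
  | j + 1, x => σ ⟨(u.drop (j * n)).take n, by simp⟩ (composeBlocks u n σ j x)

/-- Long words lose length in all sections of some level. -/
theorem exists_len_sec_lt [Finite S] [Fintype X] {N : ℕ}
    (h : ∀ w : List S, w.length = N + 1 → ∑ x : X, A.len (A.sec w [x]) ≤ N + 1) :
    ∃ m k : ℕ, 1 ≤ m ∧ ∀ u : List S, u.length = m * (N + 1) → ∀ v : List X, v.length = k →
      A.len (A.sec u v) < m * (N + 1) := by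
  classical
  have hfin : Finite {b : List S // b.length ≤ N + 1} := (List.finite_length_le S _).to_subtype
  have hne : Nonempty (({b : List S // b.length ≤ N + 1} → X → X) → X → X) := ⟨fun _ => id⟩
  have := Fintype.ofFinite (({b : List S // b.length ≤ N + 1} → X → X) → X → X)
  -- Each prefix gives a map from assignments of letter actions to blocks into the maps on `X`. The
  -- number of such maps does not depend on the level, so `m` can be fixed before `k`.
  set m := Nat.card (({b : List S // b.length ≤ N + 1} → X → X) → X → X) with hm
  obtain ⟨k, hk⟩ := exists_separating_level (A := A) (m * (N + 1))
  refine ⟨m, k, Nat.card_pos, fun u hu v hv => ?_⟩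
  by_contra! hlt
  have hper : A.len (A.sec u v) = u.length := by
    have := A.len_le_length (A.sec u v)
    rw [length_sec] at this
    omega
  have hlen : ∀ j ≤ m, (u.take (j * (N + 1))).length = j * (N + 1) := fun j hj => by
    rw [List.length_take, hu]
    exact Nat.min_eq_left (Nat.mul_le_mul_right _ hj)
  have hpre : ∀ j, A.len (A.sec (u.take (j * (N + 1))) v) = (u.take (j * (N + 1))).length :=
    fun j => len_sec_left_eq (w' := u.drop (j * (N + 1))) (by
      rw [List.take_append_drop]; exact hper)
  have hsplit : ∀ j, u.take ((j + 1) * (N + 1)) =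
      u.take (j * (N + 1)) ++ (u.drop (j * (N + 1))).take (N + 1) := fun j => by
    rw [add_mul, one_mul, List.take_add]
  -- By `path_unique` the path along which a block keeps its length depends on the block alone and
  -- not on its position in `u`. The default `[]` is not used for blocks of `u`.
  let ray : List S → List X := fun b =>
    if hb : ∃ v : List X, v.length = k ∧ A.len (A.sec b v) = N + 1 then hb.choose else []
  have hray : ∀ j < m, ray ((u.drop (j * (N + 1))).take (N + 1)) =
      A.actWord (u.take (j * (N + 1))) v := by
    intro j hj
    have h1 : ((u.drop (j * (N + 1))).take (N + 1)).length = N + 1 := by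
      have := congrArg List.length (hsplit j)
      rw [hlen _ hj, List.length_append, hlen _ hj.le, Nat.succ_mul] at this
      omega
    have h2 := hpre (j + 1)
    rw [hsplit] at h2
    have h3 := (len_sec_right_eq h2).trans h1
    have hex : ∃ v' : List X, v'.length = k ∧
        A.len (A.sec ((u.drop (j * (N + 1))).take (N + 1)) v') = N + 1 :=
      ⟨_, by rw [length_actWord, hv], h3⟩
    simp only [ray, dif_pos hex]
    exact path_unique h h1 (by rw [hex.choose_spec.1, length_actWord, hv]) hex.choose_spec.2 h3
  -- The level `i` enters only through the assignment, so equal composition maps give equal actions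
  -- at all vertices of the path simultaneously.
  have hcomp : ∀ i, ∀ j ≤ m, A.act (A.sec (u.take (j * (N + 1))) (v.take i)) =
      composeBlocks u (N + 1) (fun b => A.act (A.sec b.1 ((ray b.1).take i))) j := by
    intro i j hj
    induction j with
    | zero => funext x; simp [composeBlocks]
    | succ j ih =>
      funext x
      rw [hsplit, sec_append, act_append, ih (by omega), actWord_take, ← hray j (by omega)]
      rfl
  obtain ⟨i, j, hij, heq⟩ := Fintype.exists_ne_map_eq_of_card_lt
    (fun (j : Fin (m + 1)) (σ : {b : List S // b.length ≤ N + 1} → X → X) =>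
      composeBlocks u (N + 1) σ j)
    (by rw [← Nat.card_eq_fintype_card, ← hm, Fintype.card_fin]; omega)
  wlog hlt' : i < j generalizing i j
  · exact this j i hij.symm heq.symm (lt_of_le_of_ne (not_lt.1 hlt') hij.symm)
  have him : i.1 ≤ m := by omega
  have hjm : j.1 ≤ m := by omega
  have heval : A.eval (u.take (i * (N + 1))) = A.eval (u.take (j * (N + 1))) := by
    refine hk _ _ ?_ ?_ fun y hy => ?_
    · rw [hlen _ him]; exact Nat.mul_le_mul_right _ him
    · rw [hlen _ hjm]; exact Nat.mul_le_mul_right _ hjm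
    · refine actWord_eq_of_path h (by rw [hlen _ him]; exact dvd_mul_left _ _)
        (by rw [hlen _ hjm]; exact dvd_mul_left _ _) (hpre _) (hpre _) (fun l => ?_) y
        (hy.trans hv.ge)
      rw [hcomp l _ him, hcomp l _ hjm]
      exact congrFun heq _
  -- The longer prefix keeps its length along `v`, but represents the same element as the shorter
  -- one.
  have h1 := hpre j
  have h2 := A.len_sec_le (u.take (j * (N + 1))) v
  rw [← A.len_congr heval] at h2
  have h3 := A.len_le_length (u.take (i * (N + 1)))
  rw [hlen _ him] at h3
  rw [hlen _ hjm] at h1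
  have h4 : i.1 * (N + 1) < j.1 * (N + 1) := Nat.mul_lt_mul_of_pos_right hlt' (Nat.succ_pos N)
  omega

end InvertibleAutomaton

namespace InvertibleAutomaton

variable {S : Type u} {X : Type v} {A : InvertibleAutomaton S X}

/-! ### A quantity that decreases in every level -/

theorem take_sec (w : List S) (v : List X) (i : ℕ) :
    (A.sec w v).take i = A.sec (w.take i) v := by
  induction w generalizing v i with
  | nil => simp
  | cons s w ih =>
    cases i with
    | zero => simp
    | succ i => simp [sec, ih]

open Classical in
/-- The number of levels below `k` on which a word of `n` letters keeps its length. -/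
noncomputable def age (A : InvertibleAutomaton S X) (n k : ℕ) (c : List S) : ℕ :=
  if c.length = n then
    ((Finset.range k).filter fun j => ∃ v : List X, v.length = j ∧ A.len (A.sec c v) = n).card
  else 0

theorem age_le (n k : ℕ) (c : List S) : A.age n k c ≤ k := by
  classical
  unfold age
  split_ifs
  · exact (Finset.card_filter_le _ _).trans (by simp)
  · exact Nat.zero_le _

/-- The sum of the ages of all factors of `n` letters. -/
noncomputable def ageSum (A : InvertibleAutomaton S X) (n k : ℕ) : List S → ℕ
  | [] => 0
  | s :: w => A.age n k ((s :: w).take n) + ageSum A n k w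

theorem ageSum_append_le (n k : ℕ) (b w : List S) :
    A.ageSum n k (b ++ w) ≤ k * b.length + A.ageSum n k w := by
  induction b with
  | nil => simp
  | cons s b ih =>
    rw [List.cons_append, ageSum, List.length_cons, Nat.mul_succ]
    have := A.age_le n k ((s :: (b ++ w)).take n)
    omega

theorem ageSum_le (n k : ℕ) (w : List S) : A.ageSum n k w ≤ k * w.length := by
  simpa [ageSum] using A.ageSum_append_le n k w []

theorem le_ageSum_append (n k : ℕ) (b w : List S) : A.ageSum n k w ≤ A.ageSum n k (b ++ w) := by
  induction b with
  | nil => exact le_rfl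
  | cons s b ih => exact ih.trans (Nat.le_add_left _ _)

variable {n k : ℕ}

/-- Level `j` of a section lies in level `j + 1` of the word, and `hk` excludes level `k`. A
geodesic word also counts its level 0, which its section gives up. -/
theorem age_sec_add_le
    (hk : ∀ u : List S, u.length = n → ∀ v : List X, v.length = k → A.len (A.sec u v) < n)
    {c : List S} (hc : c.length = n) (x : X) (e : ℕ)
    (he : e = 0 ∨ (e = 1 ∧ A.len c = n)) : A.age n k (A.sec c [x]) + e ≤ A.age n k c := by
  classical
  rw [age, age, if_pos (by rw [length_sec, hc]), if_pos hc]
  have hsub : (((Finset.range k).filter fun j =>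
      ∃ v : List X, v.length = j ∧ A.len (A.sec (A.sec c [x]) v) = n).map
        ⟨Nat.succ, Nat.succ_injective⟩) ⊆ ((Finset.range k).filter fun j =>
      ∃ v : List X, v.length = j ∧ A.len (A.sec c v) = n).erase 0 := by
    intro j hj
    simp only [Finset.mem_map, Finset.mem_filter, Finset.mem_range,
      Function.Embedding.coeFn_mk] at hj
    obtain ⟨i, ⟨hi, v, hv, hlen⟩, rfl⟩ := hj
    rw [← sec_word_cons] at hlen
    simp only [Finset.mem_erase, Finset.mem_filter, Finset.mem_range]
    refine ⟨Nat.succ_ne_zero i, ?_, x :: v, by simp [hv], hlen⟩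
    by_contra hcon
    have h1 := hk c hc (x :: v) (by simp [hv]; omega)
    omega
  have hcard := Finset.card_le_card hsub
  rw [Finset.card_map] at hcard
  rcases he with rfl | ⟨rfl, he⟩
  · exact hcard.trans Finset.card_erase_le
  · rw [Finset.card_erase_of_mem] at hcard
    · have hpos : 0 < ((Finset.range k).filter fun j =>
          ∃ v : List X, v.length = j ∧ A.len (A.sec c v) = n).card := by
        apply Finset.card_pos.2
        refine ⟨0, ?_⟩
        simp only [Finset.mem_filter, Finset.mem_range]
        refine ⟨?_, [], rfl, by simpa using he⟩
        by_contra hcon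
        have h1 := hk c hc [] (by simp; omega)
        rw [sec_word_nil] at h1
        omega
      omega
    · simp only [Finset.mem_filter, Finset.mem_range]
      refine ⟨?_, [], rfl, by simpa using he⟩
      by_contra hcon
      have h1 := hk c hc [] (by simp; omega)
      rw [sec_word_nil] at h1
      omega

/-- A factor that begins in `p` ends inside `b`, so it turns into its own section and its age does
not grow. What follows `b` is not seen, and `z'` is arbitrary. -/
theorem ageSum_sec_append_le
    (hk : ∀ u : List S, u.length = n → ∀ v : List X, v.length = k → A.len (A.sec u v) < n)
    (p : List S) {b : List S} (hb : b.length = n) (z z' : List S) (x : X) :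
    A.ageSum n k (A.sec p [x] ++ (A.sec b [A.act p x] ++ z')) + A.ageSum n k (b ++ z) ≤
      A.ageSum n k (p ++ (b ++ z)) + A.ageSum n k (A.sec b [A.act p x] ++ z') := by
  induction p generalizing x with
  | nil => simp [add_comm]
  | cons s p ih =>
    have h1 : (A.sec (s :: p) [x] ++ (A.sec b [A.act (s :: p) x] ++ z')).take n =
        A.sec (((s :: p) ++ (b ++ z)).take n) [x] := by
      have e1 : n ≤ ((s :: p) ++ b).length := by simp; omega
      have e2 : ((s :: p) ++ (b ++ z)).take n = ((s :: p) ++ b).take n := by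
        rw [← List.append_assoc, List.take_append_of_le_length e1]
      rw [e2, ← List.append_assoc, ← sec_append_singleton,
        List.take_append_of_le_length (by rwa [length_sec]), take_sec]
    have h2 := age_sec_add_le hk (c := ((s :: p) ++ (b ++ z)).take n) (by simp; omega) x 0
      (.inl rfl)
    rw [← h1] at h2
    have h3 := ih (A.o s x)
    rw [act_cons]
    rw [act_cons] at h2
    have h4 : A.sec (s :: p) [x] = A.tWord s [x] :: A.sec p [A.o s x] := rfl
    rw [h4] at h2 ⊢
    simp only [List.cons_append] at h2 ⊢
    rw [ageSum, ageSum]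
    omega

/-- The age sum decreases at a block that keeps its length and is followed by such a block. -/
theorem ageSum_sec_append_lt
    (hk : ∀ u : List S, u.length = n → ∀ v : List X, v.length = k → A.len (A.sec u v) < n)
    (hn : 0 < n) {c : List S} (hc : c.length = n) (hlen : A.len c = n) {b : List S}
    (hb : b.length = n) (z z' : List S) (x : X) :
    A.ageSum n k (A.sec c [x] ++ (A.sec b [A.act c x] ++ z')) + A.ageSum n k (b ++ z) + 1 ≤
      A.ageSum n k (c ++ (b ++ z)) + A.ageSum n k (A.sec b [A.act c x] ++ z') := by
  obtain _ | ⟨s, p⟩ := c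
  · simp at hc; omega
  · have h2 := age_sec_add_le hk hc x 1 (.inr ⟨rfl, hlen⟩)
    have h3 := ageSum_sec_append_le hk p hb z z' (A.o s x)
    have h5 : ((s :: p) ++ (b ++ z)).take n = s :: p := by
      rw [List.take_append_of_le_length hc.ge, List.take_of_length_le hc.le]
    have h6 : (A.sec (s :: p) [x] ++ (A.sec b [A.act (s :: p) x] ++ z')).take n =
        A.sec (s :: p) [x] := by
      rw [List.take_append_of_le_length (by rw [length_sec]; exact hc.ge),
        List.take_of_length_le (by rw [length_sec]; exact hc.le)]
    rw [act_cons]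
    rw [act_cons] at h6
    have h4 : A.sec (s :: p) [x] = A.tWord s [x] :: A.sec p [A.o s x] := rfl
    rw [h4] at h2 h6 ⊢
    simp only [List.cons_append] at h5 h6 ⊢
    rw [ageSum, ageSum, h5, h6]
    omega

-- Per block the potential loses at least 1, up to a constant. A block that shrinks releases `2 *
-- K`, where `K = (N + 1) * k + 1`: one `K` pays for the ages at its own letters and the unit, the
-- other is the credit in the conditional term, which pays for the preceding block, whose factors
-- are disturbed. If two consecutive blocks keep their length, the age sum itself drops. Counting
-- factors at all positions makes this independent of the shifting of blocks between levels.
open Classical in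
theorem potential_redSec_le {N k : ℕ}
    (hk : ∀ u : List S, u.length = N + 1 → ∀ v : List X, v.length = k →
      A.len (A.sec u v) < N + 1) (w : List S) (x : X) :
    2 * ((N + 1) * k + 1) * (A.redSec N w x).length + A.ageSum (N + 1) k (A.redSec N w x) +
        (if A.len (A.sec (w.take (N + 1)) [x]) < N + 1 then (N + 1) * k + 1 else 0) +
        w.length / (N + 1) ≤
      2 * ((N + 1) * k + 1) * w.length + A.ageSum (N + 1) k w + (3 * ((N + 1) * k) + 2) := by
  set K := (N + 1) * k + 1 with hK
  have hshort : ∀ w : List S, w.length < 2 * (N + 1) → ∀ x : X,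
      2 * K * (A.redSec N w x).length + A.ageSum (N + 1) k (A.redSec N w x) +
        (if A.len (A.sec (w.take (N + 1)) [x]) < N + 1 then K else 0) + w.length / (N + 1) ≤
      2 * K * w.length + A.ageSum (N + 1) k w + (3 * ((N + 1) * k) + 2) := by
    -- At most `2 * (N + 1) * k` for the ages of the result, the credit `K`, and one complete block:
    -- this is the additive constant.
    intro w hw x
    have h1 := Nat.mul_le_mul_left (2 * K) (A.length_redSec_le N w x)
    have h2 := A.ageSum_le (N + 1) k (A.redSec N w x)
    have h3 : w.length / (N + 1) ≤ 1 := Nat.le_of_lt_succ ((Nat.div_lt_iff_lt_mul (by omega)).2 hw)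
    have h4 : (if A.len (A.sec (w.take (N + 1)) [x]) < N + 1 then K else 0) ≤ K := by
      split_ifs <;> omega
    have h5 : k * (A.redSec N w x).length ≤ k * (2 * (N + 1)) :=
      Nat.mul_le_mul_left k ((A.length_redSec_le N w x).trans hw.le)
    have h6 : k * (2 * (N + 1)) = 2 * ((N + 1) * k) := by ring
    omega
  induction w using blockInduction N generalizing x with
  | h w hw => exact hshort w (by omega) x
  | h' b w hb ih =>
    by_cases hw : (b ++ w).length < 2 * (N + 1)
    · exact hshort _ hw x
    · have hwl : N + 1 ≤ w.length := by rw [List.length_append] at hw; omega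
      obtain ⟨b', z, hb', rfl⟩ : ∃ b' z, b'.length = N + 1 ∧ w = b' ++ z :=
        ⟨w.take (N + 1), w.drop (N + 1), by simp; omega, (List.take_append_drop _ _).symm⟩
      have ih := ih (A.act b x)
      have htake : (b ++ (b' ++ z)).take (N + 1) = b := by
        rw [List.take_append_of_le_length hb.ge, List.take_of_length_le hb.le]
      have htake' : (b' ++ z).take (N + 1) = b' := by
        rw [List.take_append_of_le_length hb'.ge, List.take_of_length_le hb'.le]
      rw [htake'] at ih
      have e0 : (b ++ (b' ++ z)).length = N + 1 + (b' ++ z).length := by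
        rw [List.length_append, hb]
      rw [htake, redSec_append _ hb, e0, List.length_append (as := A.red _),
        Nat.add_div_left _ (by omega : 0 < N + 1), length_red,
        Nat.mul_add (2 * K) (A.len _), Nat.mul_add (2 * K) (N + 1)]
      have h1 := A.ageSum_append_le (N + 1) k (A.red (A.sec b [x]))
        (A.redSec N (b' ++ z) (A.act b x))
      have h2 := A.le_ageSum_append (N + 1) k b (b' ++ z)
      rw [length_red] at h1
      have h3 : A.len (A.sec b [x]) ≤ N + 1 := by
        simpa [hb] using A.len_le_length (A.sec b [x])
      have h4 : k * A.len (A.sec b [x]) ≤ (N + 1) * k := by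
        rw [mul_comm]; exact Nat.mul_le_mul_right k h3
      have h5 := Nat.mul_le_mul_left (2 * K) h3
      by_cases hs : A.len (A.sec b [x]) < N + 1
      · rw [if_pos hs]
        have h6 : 2 * K * A.len (A.sec b [x]) + 2 * K ≤ 2 * K * (N + 1) := by
          rw [← Nat.mul_succ]; exact Nat.mul_le_mul_left _ hs
        omega
      · rw [if_neg hs]
        by_cases hs' : A.len (A.sec b' [A.act b x]) < N + 1
        · rw [if_pos hs'] at ih
          omega
        · rw [if_neg hs'] at ih
          -- Ages are compared on literal factors, so it matters that `red` leaves geodesic words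
          -- unchanged.
          have e1 : A.red (A.sec b [x]) = A.sec b [x] := A.red_eq_self (by
            rw [length_sec]; omega)
          have h7 : A.len (A.sec b' [A.act b x]) ≤ N + 1 := by
            simpa [hb'] using A.len_le_length (A.sec b' [A.act b x])
          have e2 : A.red (A.sec b' [A.act b x]) = A.sec b' [A.act b x] := A.red_eq_self (by
            rw [length_sec]; omega)
          have h8 : A.len b = N + 1 := by
            have := A.len_le_length b
            have := A.len_sec_le b [x]
            omega
          have h9 := ageSum_sec_append_lt hk (by omega) hb h8 hb' z
            (A.redSec N z (A.act b' (A.act b x))) x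
          rw [redSec_append _ hb', e2] at ih ⊢
          rw [e1]
          omega

end InvertibleAutomaton

/-! ### Time n log n. -/

namespace WordProblemMachine

variable {S : Type u} {X : Type v} [Fintype X] {A : InvertibleAutomaton S X}

theorem mem_quasilinearTime [Finite S] (hinv : ∀ s : S, ∃ s' : S, A.gen s' = (A.gen s)⁻¹)
    (T : Finset A.group) {N₀ : ℕ}
    (h : ∀ w : List S, w.length = N₀ + 1 → ∑ x : X, A.len (A.sec w [x]) ≤ N₀ + 1) :
    wordProblem T ∈ DTIMEMulti (fun n => (n : ℝ) * Real.log n) T := by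
  obtain ⟨m, k, hm, hk⟩ := A.exists_len_sec_lt h
  obtain ⟨N, hN⟩ : ∃ N, m * (N₀ + 1) = N + 1 :=
    Nat.exists_eq_succ_of_ne_zero (Nat.mul_pos hm (Nat.succ_pos _)).ne'
  rw [hN] at hk
  -- The sum condition passes to multiples of the block length, so the longer blocks satisfy it as
  -- well.
  have hsum : ∀ w : List S, w.length = N + 1 → ∑ x : X, A.len (A.sec w [x]) + 0 ≤ N + 1 :=
    fun w hw => (A.sum_len_sec_le h (by rw [hw, ← hN]; exact dvd_mul_left _ _)).trans hw.le
  set E := 2 * ((N + 1) * k + 1) with hE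
  set R := 3 * ((N + 1) * k) + 2 with hR
  set c := Fintype.card X * (N + 1) with hc
  have hEk : (0 : ℝ) ≤ k := Nat.cast_nonneg _
  have hE2 : (2 : ℝ) ≤ E := by exact_mod_cast (by omega : 2 ≤ E)
  have hΦK : ∀ w : List S, ((E * w.length + A.ageSum (N + 1) k w : ℕ) : ℝ) ≤
      (E + k) * w.length := fun w => by
    have := A.ageSum_le (N + 1) k w
    exact_mod_cast (by rw [add_mul]; omega :
      E * w.length + A.ageSum (N + 1) k w ≤ (E + k) * w.length)
  -- With `q` complete blocks the potential drops by `q - R`, while it is at most `E + k` times the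
  -- length and the length is at most `2 * (N + 1) * (q - R)`.
  set M : ℕ := 2 * (N + 1) * (E + k) with hM
  have hM4 : 2 ≤ M := by
    rw [hM]
    calc 2 = 2 * 1 * 1 := rfl
      _ ≤ 2 * (N + 1) * (E + k) := Nat.mul_le_mul (by omega) (by omega)
  have hM0 : (0 : ℝ) < M := by exact_mod_cast (by omega : 0 < M)
  have hρ : (0 : ℝ) < 1 - 1 / M := by
    have h1 : (1 : ℝ) / M < 1 := by
      rw [div_lt_one hM0]; exact_mod_cast (by omega : 1 < M)
    linarith
  have hρ1 : (1 : ℝ) - 1 / M < 1 := by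
    have : (0 : ℝ) < 1 / M := by positivity
    linarith
  have hc0 : (0 : ℝ) ≤ c := Nat.cast_nonneg _
  obtain ⟨C, hC, H⟩ := exists_decidesInTime_wordProblem (A := A) hinv T (N := N)
    -- The first summand makes `q ≥ 2 * R + 2`, so that the drop `q - R` is proportional to the
    -- length; the second makes `F` positive on long words.
    (B₀ := (N + 1) * (2 * R + 2) + c)
    (Φ := fun w => ((E * w.length + A.ageSum (N + 1) k w : ℕ) : ℝ))
    (F := fun w => ((w.length - c : ℕ) : ℝ)) (μ := 1) (K := (E + k) + (c + 1))
    hρ.le zero_le_one (by positivity)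
    (fun w => by
      have : 1 * w.length ≤ E * w.length := Nat.mul_le_mul_right _ (by omega)
      exact_mod_cast (by omega : w.length ≤ E * w.length + A.ageSum (N + 1) k w))
    (fun w => (hΦK w).trans (mul_le_mul_of_nonneg_right (by linarith) (Nat.cast_nonneg _)))
    (fun w x hw => by
      classical
      have h1 := A.potential_redSec_le hk w x
      rw [← hE, ← hR] at h1
      have h2 := Nat.div_add_mod w.length (N + 1)
      have h3 := Nat.mod_lt w.length (by omega : 0 < N + 1)
      have h4 : 2 * R + 2 ≤ w.length / (N + 1) := by
        rw [Nat.le_div_iff_mul_le (by omega), mul_comm]; omega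
      set q := w.length / (N + 1) with hq
      have h5 : w.length ≤ 2 * (N + 1) * (q - R) := by
        have h6 : q + 1 ≤ 2 * (q - R) := by omega
        calc w.length ≤ (N + 1) * (q + 1) := by rw [Nat.mul_succ]; omega
          _ ≤ (N + 1) * (2 * (q - R)) := Nat.mul_le_mul_left _ h6
          _ = _ := by ring
      have h6 : (w.length : ℝ) ≤ 2 * (N + 1) * ((q - R : ℕ) : ℝ) := by exact_mod_cast h5
      have h7 : ((E * (A.redSec N w x).length + A.ageSum (N + 1) k (A.redSec N w x) : ℕ) : ℝ) +
          ((q - R : ℕ) : ℝ) ≤ ((E * w.length + A.ageSum (N + 1) k w : ℕ) : ℝ) := by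
        exact_mod_cast (by omega : E * (A.redSec N w x).length +
          A.ageSum (N + 1) k (A.redSec N w x) + (q - R) ≤
          E * w.length + A.ageSum (N + 1) k w)
      have h8 : 1 / (M : ℝ) * ((E * w.length + A.ageSum (N + 1) k w : ℕ) : ℝ) ≤
          ((q - R : ℕ) : ℝ) := by
        rw [one_div, inv_mul_le_iff₀ hM0]
        calc ((E * w.length + A.ageSum (N + 1) k w : ℕ) : ℝ) ≤ (E + k) * w.length := hΦK w
          _ ≤ (E + k) * (2 * (N + 1) * ((q - R : ℕ) : ℝ)) :=
            mul_le_mul_of_nonneg_left h6 (by positivity)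
          _ = M * ((q - R : ℕ) : ℝ) := by rw [hM]; push_cast; ring
      rw [sub_mul, one_mul]
      linarith)
    (fun _ => Nat.cast_nonneg _) (fun w => by exact_mod_cast Nat.sub_le _ _)
    (fun w hw => (le_mul_tsub (c := c) (by omega)).trans
      (mul_le_mul_of_nonneg_right (by linarith) (Nat.cast_nonneg _)))
    (fun w _ => by
      have h1 := A.sum_length_redSec_le hsum w
      rw [zero_mul, add_zero] at h1
      have h2 := sum_tsub_le (fun x => A.length_redSec_le N w x) h1
      rw [one_mul]
      exact_mod_cast h2)
  obtain ⟨D, hD, hD'⟩ := exists_depth hρ hρ1 hC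
  obtain ⟨f, hf, l, P, hP⟩ := H D hD
  exact ⟨l, P, f, isBigO_mul_log hρ hρ1 hC hD' hf, hP⟩

end WordProblemMachine

/-! ### The theorem. -/

theorem InvertibleAutomaton.fg_group {S : Type u} {X : Type v} [Finite S]
    (A : InvertibleAutomaton S X) : Group.FG A.group :=
  (Group.fg_iff_subgroup_fg _).2 (Subgroup.fg_iff _ |>.2 ⟨_, rfl, Set.finite_range _⟩)

theorem mainTheorem3 {S : Type u} {X : Type v} [Fintype S] [Fintype X]
    (A : InvertibleAutomaton S X)
    (hmin : Function.Injective A.gen)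
    (hinv : ∀ s : S, ∃ s' : S, A.gen s' = (A.gen s)⁻¹)
    (L : ℕ) (hL : 1 ≤ L) :
    ((∀ w : List S, w.length = L → ∀ x : X, A.len (A.sec w [x]) < w.length) →
      WordProblemIn A.group PolyTime) ∧
    ((∀ w : List S, w.length = L → ∑ x : X, A.len (A.sec w [x]) ≤ w.length) →
      WordProblemIn A.group (DTIMEMulti fun n => (n : ℝ) * Real.log n)) ∧
    ((∀ w : List S, w.length = L → ∑ x : X, A.len (A.sec w [x]) < w.length) →
      WordProblemIn A.group (DTIMEMulti fun n => (n : ℝ))) := by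
  obtain ⟨N, rfl⟩ : ∃ N, L = N + 1 := ⟨L - 1, by omega⟩
  refine ⟨fun h => ⟨A.fg_group, fun T _ _ => ?_⟩, fun h => ⟨A.fg_group, fun T _ _ => ?_⟩,
    fun h => ⟨A.fg_group, fun T _ _ => ?_⟩⟩
  · exact WordProblemMachine.mem_polyTime hinv T fun w hw x => (h w hw x).trans_eq hw
  · exact WordProblemMachine.mem_quasilinearTime hinv T fun w hw => (h w hw).trans_eq hw
  · exact WordProblemMachine.mem_linearTime hinv T fun w hw => (h w hw).trans_eq hw
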